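/- Let $V,H$ be real separable Hilbert spaces with $V$ continuously, injectively and densely embedded in $H$, identify $H$ with its dual, so that $V\subset H\subset V'$, and let $c_V,c_H$ be constants with $\|v\|_H\le c_V\|v\|_V$ for $v\in V$ and $\|h\|_{V'}\le c_H\|h\|_H$ for $h\in H$. Let $U$ be a finite-dimensional real Hilbert space, $B\in\mathcal L(U,H)$, $Q,P\in\mathcal L(H)$, and $\mathfrak S=[-\tfrac12,\tfrac12]^{\mathbb N}$. For $\sigma\in\mathfrak S$ let $\mathcal A_\sigma\in\mathcal L(V,V')$, and assume that there are continuous bilinear forms $a(\sigma;\cdot,\cdot)$ on $V$ and constants $\rho\in\mathbb R$, $\theta>0$, $C_{\mathcal A}$ such that for all $\sigma\in\mathfrak S$: (A1) $\langle\mathcal A_\sigma v,w\rangle_{V',V}=-a(\sigma;v,w)$ for all $v,w\in V$; (A2) $a(\sigma;v,v)+\rho\|v\|_H^2\ge\theta\|v\|_V^2$ for all $v\in V$; (A3) $\|\mathcal A_\sigma\|_{\mathcal L(V,V')}\le C_{\mathcal A}$. For $T>0$ and a Hilbert space $X$ put $X_T=L^2(0,T;X)$, and let $W_T=\{w\in V_T:\dot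 w\in V_T'\}$, where $V'_T=L^2(0,T;V')$ and $\dot w$ is the weak time derivative, with norm $\|w\|_{W_T}^2=\|w\|_{V_T}^2+\|\dot w\|_{V'_T}^2$. Every $w\in W_T$ has a continuous representative $[0,T]\to H$, and $E_tw=w(t)\in H$ denotes its value at $t$. Products carry the Hilbert product norm. Define $$A_\sigma w=\begin{pmatrix}\dot w-\mathcal A_\sigma w\\ E_0w\end{pmatrix}\in V_T'\times H,\qquad G_\sigma=\begin{bmatrix}\tfrac{\mathrm d}{\mathrm dt}-\mathcal A_\sigma&-BB^*\\ E_0&0\\ Q^*Q&-\tfrac{\mathrm d}{\mathrm dt}-\mathcal A_\sigma^*\\ P^*PE_T&E_T\end{bmatrix}:W_T\times W_T\to V_T'\times H\times V_T'\times H .$$ With $\rho_+=\max\{\rho,0\}$ set $$\kappa(T)=2\rho_+T\,\max\{1,\tfrac1{2\theta}\}\,e^{2\rho_+T},\qquad \mathfrak C_1(T)=1+\theta^{-1}+\kappa(T),$$ $$c_A(T)^2=(1+2C_{\mathcal A}^2)\frac{1+\kappa(T)}{\theta}+(1+2C_{\mathcal A}^2)\frac{\kappa(T)}{\theta}+\frac{1+2C_{\mathcal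 A}^2}{\theta^2}+2,$$ $$\phi(T)=\big(\theta^{-1}+\kappa(T)+c_A(T)^2\big)c_H^2\|B\|^2,$$ $$\mathfrak C_u(T)^2=2\big(\|Q\|^2c_V^2c_A(T)^2+\|P\|^2\mathfrak C_1(T)+4\phi(T)\big),$$ $$\mathfrak C_y(T)^2=2c_A(T)^2\big(c_H^2\|B\|^2\mathfrak C_u(T)^2+1\big),$$ $$\mathfrak C_q(T)^2=2c_A(T)^2\Big(c_H^2\big(1+\|Q^*Q\|^2c_V^2\mathfrak C_y(T)^2\big)+1+2\|P^*P\|^2\mathfrak C_1(T)\big(c_H^2\|B\|^2\mathfrak C_u(T)^2+1\big)\Big),$$ all these roots being nonnegative, and $$c_{\mathcal G}(T)=\big(\mathfrak C_y(T)^2+\mathfrak C_q(T)^2\big)^{1/2}.$$ Then for every $T>0$ and every $\sigma\in\mathfrak S$ the operators $A_\sigma\in\mathcal L(W_T,V_T'\times H)$ and $G_\sigma\in\mathcal L(W_T\times W_T,V_T'\times H\times V_T'\times H)$ are bounded linear bijections with bounded inverses, and $$\|A_\sigma^{-1}\|_{\mathcal L(V'_T\times H,\,W_T)}\le c_A(T),\qquad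 \|G_\sigma^{-1}\|_{\mathcal L(V_T'\times H\times V_T'\times H,\;W_T\times W_T)}\le c_{\mathcal G}(T).$$ The constant $c_{\mathcal G}(T)$ does not depend on $\sigma$; the function $T\mapsto c_{\mathcal G}(T)$, defined by the formula above on $[0,\infty)$, is continuous and monotonically increasing there, and it stays bounded as $T\to0$. -/

import Mathlib

open MeasureTheory Set Filter Topology
open scoped ContDiff

noncomputable section

/-- The parameter set `[-1/2, 1/2]^ℕ`. -/
def paramSet : Set (ℕ → ℝ) := Set.univ.pi fun _ => Set.Icc (-1 / 2 : ℝ) (1 / 2)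

section Spaces

variable {V H : Type*} [NormedAddCommGroup V] [InnerProductSpace ℝ V]
  [NormedAddCommGroup H] [InnerProductSpace ℝ H]

/-- The embedding `H → V'` of the Gelfand triple `V ⊂ H ⊂ V'` (with `H` identified with its dual):
`h` acts on `v` as `⟨h, ι v⟩_H`. -/
def pivotEmb (ι : V →L[ℝ] H) : H →L[ℝ] StrongDual ℝ V :=
  ((ContinuousLinearMap.compL ℝ V H ℝ).flip ι).comp (innerSL ℝ)

theorem pivotEmb_apply (ι : V →L[ℝ] H) (h : H) (v : V) :
    pivotEmb ι h v = inner ℝ h (ι v) := rfl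

/-- Lebesgue measure on the time interval `(0, T)`. -/
abbrev timeMeasure (T : ℝ) : Measure ℝ := volume.restrict (Set.Ioo 0 T)

/-- The Bochner space `L²(0, T; X)`. -/
abbrev L2T (T : ℝ) (X : Type*) [NormedAddCommGroup X] := Lp X 2 (timeMeasure T)

/-- `dy ∈ L²(0,T;V')` is the weak time derivative of `y ∈ L²(0,T;V)`, where `V` is regarded as a
subspace of `V'`. -/
def IsWeakTimeDeriv (ι : V →L[ℝ] H) (T : ℝ) (y : L2T T V) (dy : L2T T (StrongDual ℝ V)) : Prop :=
  ∀ φ : ℝ → ℝ, ContDiff ℝ ∞ φ → HasCompactSupport φ → tsupport φ ⊆ Set.Ioo 0 T →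
    ∫ t in Set.Ioo 0 T, deriv φ t • pivotEmb ι (ι (y t)) = - ∫ t in Set.Ioo 0 T, φ t • dy t

theorem integrable_test_smul {X : Type*} [NormedAddCommGroup X] [NormedSpace ℝ X] {T : ℝ}
    {ψ : ℝ → ℝ} (hψ : Continuous ψ) (hc : HasCompactSupport ψ) (y : L2T T X) :
    Integrable (fun t => ψ t • y t) (timeMeasure T) := by
  obtain ⟨C, hC⟩ := hc.exists_bound_of_continuous hψ
  have hy : Integrable (fun t => y t) (timeMeasure T) := (Lp.memLp y).integrable one_le_two
  exact hy.bdd_smul C hψ.aestronglyMeasurable (Eventually.of_forall hC)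

theorem integrable_deriv_test_smul (ι : V →L[ℝ] H) {T : ℝ} {φ : ℝ → ℝ} (hφ : ContDiff ℝ ∞ φ)
    (hc : HasCompactSupport φ) (y : L2T T V) :
    Integrable (fun t => deriv φ t • pivotEmb ι (ι (y t))) (timeMeasure T) := by
  have h := ((pivotEmb ι).comp ι).integrable_comp
    (integrable_test_smul (hφ.continuous_deriv (by simp)) hc.deriv y)
  simpa using h

/-- The space `W(0,T;V,V')` as a subspace of `L²(0,T;V) × L²(0,T;V')`. An element is a pair
`(y, y')` with `y'` the weak derivative of `y` (which `y` determines), and the norm is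
`(‖y‖²_{L²(0,T;V)} + ‖y'‖²_{L²(0,T;V')})^(1/2)`. -/
def WSubmodule (ι : V →L[ℝ] H) (T : ℝ) :
    Submodule ℝ (WithLp 2 (L2T T V × L2T T (StrongDual ℝ V))) where
  carrier := {w | IsWeakTimeDeriv ι T w.fst w.snd}
  zero_mem' := by
    intro φ hφ hc hs
    have h1 : ∀ᵐ t ∂(timeMeasure T), deriv φ t • pivotEmb ι (ι ((0 : L2T T V) t)) = 0 := by
      filter_upwards [Lp.coeFn_zero V 2 (timeMeasure T)] with t ht
      rw [ht]; simp
    have h2 : ∀ᵐ t ∂(timeMeasure T), φ t • (0 : L2T T (StrongDual ℝ V)) t = 0 := by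
      filter_upwards [Lp.coeFn_zero (StrongDual ℝ V) 2 (timeMeasure T)] with t ht
      rw [ht]; simp
    change ∫ t in Set.Ioo 0 T, deriv φ t • pivotEmb ι (ι ((0 : L2T T V) t))
      = - ∫ t in Set.Ioo 0 T, φ t • (0 : L2T T (StrongDual ℝ V)) t
    rw [integral_eq_zero_of_ae h1, integral_eq_zero_of_ae h2, neg_zero]
  add_mem' := by
    intro w z hw hz φ hφ hc hs
    have h1 : ∀ᵐ t ∂(timeMeasure T), deriv φ t • pivotEmb ι (ι ((w.fst + z.fst : L2T T V) t))
        = deriv φ t • pivotEmb ι (ι (w.fst t)) + deriv φ t • pivotEmb ι (ι (z.fst t)) := by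
      filter_upwards [Lp.coeFn_add w.fst z.fst] with t ht
      rw [ht]; simp
    have h2 : ∀ᵐ t ∂(timeMeasure T), φ t • (w.snd + z.snd : L2T T (StrongDual ℝ V)) t
        = φ t • w.snd t + φ t • z.snd t := by
      filter_upwards [Lp.coeFn_add w.snd z.snd] with t ht
      rw [ht]; simp
    change ∫ t in Set.Ioo 0 T, deriv φ t • pivotEmb ι (ι ((w.fst + z.fst : L2T T V) t))
      = - ∫ t in Set.Ioo 0 T, φ t • (w.snd + z.snd : L2T T (StrongDual ℝ V)) t
    rw [integral_congr_ae h1, integral_congr_ae h2,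
      integral_add (integrable_deriv_test_smul ι hφ hc _) (integrable_deriv_test_smul ι hφ hc _),
      integral_add (integrable_test_smul hφ.continuous hc _)
        (integrable_test_smul hφ.continuous hc _), hw φ hφ hc hs, hz φ hφ hc hs, neg_add]
  smul_mem' := by
    intro c w hw φ hφ hc hs
    have h1 : ∀ᵐ t ∂(timeMeasure T), deriv φ t • pivotEmb ι (ι ((c • w.fst : L2T T V) t))
        = c • (deriv φ t • pivotEmb ι (ι (w.fst t))) := by
      filter_upwards [Lp.coeFn_smul c w.fst] with t ht
      rw [ht]; simp [smul_comm c]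
    have h2 : ∀ᵐ t ∂(timeMeasure T), φ t • (c • w.snd : L2T T (StrongDual ℝ V)) t
        = c • (φ t • w.snd t) := by
      filter_upwards [Lp.coeFn_smul c w.snd] with t ht
      rw [ht]; simp [smul_comm c]
    change ∫ t in Set.Ioo 0 T, deriv φ t • pivotEmb ι (ι ((c • w.fst : L2T T V) t))
      = - ∫ t in Set.Ioo 0 T, φ t • (c • w.snd : L2T T (StrongDual ℝ V)) t
    rw [integral_congr_ae h1, integral_congr_ae h2, integral_smul, integral_smul,
      hw φ hφ hc hs, smul_neg]

/-- `W_T(V,V')` as a normed space. -/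
abbrev WT (ι : V →L[ℝ] H) (T : ℝ) := ↥(WSubmodule ι T)

/-- The underlying function `w ∈ L²(0,T;V)`. -/
def WT.fn {ι : V →L[ℝ] H} {T : ℝ} (w : WT ι T) : L2T T V := w.1.fst

/-- The weak time derivative `dw/dt ∈ L²(0,T;V')`. -/
def WT.dt {ι : V →L[ℝ] H} {T : ℝ} (w : WT ι T) : L2T T (StrongDual ℝ V) := w.1.snd

/-- `u : [0,T] → H` is a continuous representative of `w`. -/
def IsContRep {ι : V →L[ℝ] H} {T : ℝ} (w : WT ι T) (u : ℝ → H) : Prop :=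
  ContinuousOn u (Set.Icc 0 T) ∧ ∀ᵐ t ∂(timeMeasure T), u t = ι (w.fn t)

open Classical in
/-- The evaluation `E_t w = w(t) ∈ H`, `t ∈ [0,T]`, through the continuous representative of `w`
(which is unique on `[0,T]` when `0 < T`). -/
def evalT {ι : V →L[ℝ] H} {T : ℝ} (t : ℝ) (w : WT ι T) : H :=
  if h : ∃ u : ℝ → H, IsContRep w u then h.choose t else 0

/-- The space `L²(0,T;V') × H` with the Hilbert product norm. -/
abbrev DataT (V H : Type*) [NormedAddCommGroup V] [InnerProductSpace ℝ V]
    [NormedAddCommGroup H] [InnerProductSpace ℝ H] (T : ℝ) :=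
  WithLp 2 (L2T T (StrongDual ℝ V) × H)

/-- The parabolic evolution operator `w ↦ (dw/dt - 𝒜 w, w(0))`. -/
def parabolicOp (ι : V →L[ℝ] H) (T : ℝ) (𝒜 : V →L[ℝ] StrongDual ℝ V) (w : WT ι T) :
    DataT V H T :=
  WithLp.toLp 2 (w.dt - 𝒜.compLp w.fn, evalT 0 w)

variable {U : Type*} [NormedAddCommGroup U] [InnerProductSpace ℝ U]
  [CompleteSpace H] [CompleteSpace U]

/-- The saddle point operator. It maps `(w₁, w₂) ∈ W_T × W_T` to the four components
`dw₁/dt - 𝒜 w₁ - B B* w₂`, `w₁(0)`, `Q* Q w₁ - dw₂/dt - 𝒜* w₂`, `P* P w₁(T) + w₂(T)`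
of `(L²(0,T;V') × H) × (L²(0,T;V') × H)`; here `𝒜.flip` is `𝒜* : V → V'`. -/
def saddleOp (ι : V →L[ℝ] H) (T : ℝ) (𝒜 : V →L[ℝ] StrongDual ℝ V) (B : U →L[ℝ] H)
    (Q P : H →L[ℝ] H) (w : WithLp 2 (WT ι T × WT ι T)) :
    WithLp 2 (DataT V H T × DataT V H T) :=
  WithLp.toLp 2
    (WithLp.toLp 2
      (w.fst.dt - 𝒜.compLp w.fst.fn - (pivotEmb ι ∘L B ∘L B.adjoint ∘L ι).compLp w.snd.fn,
       evalT 0 w.fst),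
     WithLp.toLp 2
      ((pivotEmb ι ∘L Q.adjoint ∘L Q ∘L ι).compLp w.fst.fn - w.snd.dt
          - 𝒜.flip.compLp w.snd.fn,
       P.adjoint (P (evalT T w.fst)) + evalT T w.snd))

end Spaces

section Constants

/-- `2 ρ₊ T max{1, 1/(2θ)} exp(2 ρ₊ T)` with `ρ₊ = max{ρ, 0}`. -/
def kappaConst (θ ρ T : ℝ) : ℝ :=
  2 * max ρ 0 * T * max 1 (1 / (2 * θ)) * Real.exp (2 * max ρ 0 * T)

/-- The constant `𝔠₁(T) = 1 + 1/θ + κ(T)`. -/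
def cOne (θ ρ T : ℝ) : ℝ := 1 + θ⁻¹ + kappaConst θ ρ T

/-- The constant `c_A(T)`. -/
def cA (θ ρ CA T : ℝ) : ℝ :=
  √((1 + 2 * CA ^ 2) * ((1 + kappaConst θ ρ T) / θ) + (1 + 2 * CA ^ 2) * (kappaConst θ ρ T / θ)
    + (1 + 2 * CA ^ 2) / θ ^ 2 + 2)

variable {H U : Type*} [NormedAddCommGroup H] [InnerProductSpace ℝ H] [CompleteSpace H]
  [NormedAddCommGroup U] [InnerProductSpace ℝ U]

/-- The constant `φ(T)`. -/
def phiConst (θ ρ CA cH : ℝ) (B : U →L[ℝ] H) (T : ℝ) : ℝ :=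
  (θ⁻¹ + kappaConst θ ρ T + cA θ ρ CA T ^ 2) * cH ^ 2 * ‖B‖ ^ 2

/-- The constant `ℭ_u(T)`. -/
def cU (θ ρ CA cH cV : ℝ) (B : U →L[ℝ] H) (Q P : H →L[ℝ] H) (T : ℝ) : ℝ :=
  √(2 * (‖Q‖ ^ 2 * cV ^ 2 * cA θ ρ CA T ^ 2 + ‖P‖ ^ 2 * cOne θ ρ T
    + 4 * phiConst θ ρ CA cH B T))

/-- The constant `ℭ_y(T)`. -/
def cY (θ ρ CA cH cV : ℝ) (B : U →L[ℝ] H) (Q P : H →L[ℝ] H) (T : ℝ) : ℝ :=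
  √(cA θ ρ CA T ^ 2 * (2 * (cH ^ 2 * ‖B‖ ^ 2 * cU θ ρ CA cH cV B Q P T ^ 2 + 1)))

/-- The constant `ℭ_q(T)`. -/
def cQ (θ ρ CA cH cV : ℝ) (B : U →L[ℝ] H) (Q P : H →L[ℝ] H) (T : ℝ) : ℝ :=
  √(cA θ ρ CA T ^ 2 * 2 *
    (cH ^ 2 * (1 + ‖Q.adjoint ∘L Q‖ ^ 2 * cV ^ 2 * cY θ ρ CA cH cV B Q P T ^ 2) + 1
      + ‖P.adjoint ∘L P‖ ^ 2 * cOne θ ρ T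
        * (2 * (cH ^ 2 * ‖B‖ ^ 2 * cU θ ρ CA cH cV B Q P T ^ 2 + 1))))

/-- The constant `c_𝒢(T) = (ℭ_y(T)² + ℭ_q(T)²)^(1/2)`. -/
def cG (θ ρ CA cH cV : ℝ) (B : U →L[ℝ] H) (Q P : H →L[ℝ] H) (T : ℝ) : ℝ :=
  √(cY θ ρ CA cH cV B Q P T ^ 2 + cQ θ ρ CA cH cV B Q P T ^ 2)

end Constants

end

/-! Everything rests on one energy identity. Through the Riesz map V' → V, a weak derivative of w in
L²(0,T;V') means that ι*ι w is a.e. a primitive x of an L²(0,T;V) function. The resolvents R_n =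
(ι*ι + 1/(n+1))⁻¹ commute with ι*ι, so the chain rule for ‖ι R_n x‖² is elementary; it shows that ι
R_n x is uniformly Cauchy in H. The limit is a continuous representative of w satisfying ‖w(t)‖² =
‖w(0)‖² + 2∫⟨w', w⟩ (`exists_continuousOn_rep`), and polarisation gives integration by parts.

This identity, the Gårding inequality, Young and Gronwall give the a priori bound `norm_sq_le_cA`,
so the parabolic operator is injective with closed range. An element orthogonal to the range solves
the homogeneous backward adjoint problem with zero terminal value; the same bound after time
reversal makes it vanish (`parabolicRiesz_orthogonal`). Hence the operator is an isomorphism, and so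
is its backward counterpart.

The saddle point operator is the optimality system of a linear-quadratic control problem: y = w₁ is
the state, q = w₂ the adjoint state, u = B*q the control. Existence: Lax–Milgram solves the
variational equation for u, and q comes from the backward problem (`exists_optimality_solution`).
Stability: testing the optimality condition with u itself, the quadratic observation terms have a
favourable sign, which bounds u by the data (`norm_sq_control_le`); the parabolic bound then
controls y and q. The parameter σ enters only through θ, ρ and the bound on the norm of the
operator. -/

noncomputable section

/-! ### Primitives, integration by parts and weak derivatives of Banach-valued functions -/

section Primitives

variable {E F G : Type*} [NormedAddCommGroup E] [NormedSpace ℝ E] [CompleteSpace E]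
  [NormedAddCommGroup F] [NormedSpace ℝ F] [CompleteSpace F]
  [NormedAddCommGroup G] [NormedSpace ℝ G] [CompleteSpace G]

/-- Integration by parts for the product of two primitives, with respect to a measure on `ℝ`. -/
theorem integral_bilin_setIntegral_Iic_add {μ : Measure ℝ} [SFinite μ] (L : E →L[ℝ] F →L[ℝ] G)
    {f : ℝ → E} {g : ℝ → F} (hf : Integrable f μ) (hg : Integrable g μ) :
    (∫ s, L (f s) (∫ r in Iic s, g r ∂μ) ∂μ) + ∫ r, L (∫ s in Iio r, f s ∂μ) (g r) ∂μ
      = L (∫ s, f s ∂μ) (∫ r, g r ∂μ) := by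
  have hI : Integrable (fun z : ℝ × ℝ => L (f z.1) (g z.2)) (μ.prod μ) :=
    hf.op_fst_snd (op := fun x y => L x y) L.continuous₂ ⟨‖L‖, fun x y => L.le_opNorm₂ x y⟩ hg
  -- Fubini on the two triangles r ≤ s and s < r of the square. Pairing `Iic` with `Iio` counts the
  -- diagonal once, so atoms of μ do no harm.
  have hS : MeasurableSet {z : ℝ × ℝ | z.2 ≤ z.1} := measurableSet_le measurable_snd measurable_fst
  have hprod : ∫ z, L (f z.1) (g z.2) ∂(μ.prod μ) = L (∫ s, f s ∂μ) (∫ r, g r ∂μ) := by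
    rw [integral_prod _ hI]
    calc ∫ s, ∫ r, L (f s) (g r) ∂μ ∂μ = ∫ s, L (f s) (∫ r, g r ∂μ) ∂μ := by
          refine integral_congr_ae (Eventually.of_forall fun s => ?_)
          exact (L (f s)).integral_comp_comm hg
      _ = _ := (L.flip (∫ r, g r ∂μ)).integral_comp_comm hf
  have h1 : ∫ z in {z : ℝ × ℝ | z.2 ≤ z.1}, L (f z.1) (g z.2) ∂(μ.prod μ)
      = ∫ s, L (f s) (∫ r in Iic s, g r ∂μ) ∂μ := by
    rw [← integral_indicator hS, integral_prod _ (hI.indicator hS)]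
    refine integral_congr_ae (Eventually.of_forall fun s => ?_)
    dsimp only
    rw [← (L (f s)).integral_comp_comm hg.integrableOn, ← integral_indicator measurableSet_Iic]
    rfl
  have h2 : ∫ z in {z : ℝ × ℝ | z.2 ≤ z.1}ᶜ, L (f z.1) (g z.2) ∂(μ.prod μ)
      = ∫ r, L (∫ s in Iio r, f s ∂μ) (g r) ∂μ := by
    rw [← integral_indicator hS.compl, integral_prod_symm _ (hI.indicator hS.compl)]
    refine integral_congr_ae (Eventually.of_forall fun r => ?_)
    dsimp only
    have := (L.flip (g r)).integral_comp_comm (hf.integrableOn (s := Iio r))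
    simp only [ContinuousLinearMap.flip_apply] at this
    rw [← this, ← integral_indicator measurableSet_Iio]
    refine integral_congr_ae (Eventually.of_forall fun s => ?_)
    by_cases h : s < r <;> simp [indicator, h]
  rw [← hprod, ← h1, ← h2]
  exact integral_add_compl hS hI

/-- A product rule for merely integrable f and g: neither primitive has to be differentiated. Since
Lebesgue measure has no atoms, both inner integrals may be written over the same kind of interval.
-/
theorem integral_bilin_primitive (L : E →L[ℝ] F →L[ℝ] G) {f : ℝ → E} {g : ℝ → F} {a b : ℝ}
    (hab : a ≤ b) (hf : IntervalIntegrable f volume a b) (hg : IntervalIntegrable g volume a b) :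
    (∫ s in a..b, L (f s) (∫ r in a..s, g r)) + ∫ s in a..b, L (∫ r in a..s, f r) (g s)
      = L (∫ s in a..b, f s) (∫ s in a..b, g s) := by
  have key := integral_bilin_setIntegral_Iic_add L
    ((intervalIntegrable_iff_integrableOn_Ioc_of_le hab).1 hf)
    ((intervalIntegrable_iff_integrableOn_Ioc_of_le hab).1 hg)
  simp only [intervalIntegral.integral_of_le hab]
  rw [← key]
  congr 1
  · refine setIntegral_congr_fun measurableSet_Ioc fun s hs => ?_
    rw [intervalIntegral.integral_of_le hs.1.le, Measure.restrict_restrict measurableSet_Iic,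
      inter_comm, Ioc_inter_Iic, min_eq_right hs.2]
  · refine setIntegral_congr_fun measurableSet_Ioc fun s hs => ?_
    rw [intervalIntegral.integral_of_le hs.1.le, Measure.restrict_restrict measurableSet_Iio,
      inter_comm, integral_Ioc_eq_integral_Ioo]
    have : Ioo a s = Ioc a b ∩ Iio s := by
      ext x
      simp only [mem_Ioo, mem_inter_iff, mem_Ioc, mem_Iio]
      constructor
      · rintro ⟨h1, h2⟩; exact ⟨⟨h1, h2.le.trans hs.2⟩, h2⟩
      · rintro ⟨⟨h1, _⟩, h2⟩; exact ⟨h1, h2⟩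
    rw [this]

omit [CompleteSpace E] [CompleteSpace F] [CompleteSpace G] in
theorem intervalIntegrable_bilin_of_continuousOn (L : E →L[ℝ] F →L[ℝ] G) {f : ℝ → E} {g : ℝ → F}
    {a b : ℝ} (hf : IntervalIntegrable f volume a b) (hg : ContinuousOn g (uIcc a b)) :
    IntervalIntegrable (fun s => L (f s) (g s)) volume a b := by
  obtain ⟨C, hC⟩ := isCompact_uIcc.exists_bound_of_continuousOn hg
  rw [intervalIntegrable_iff] at hf ⊢
  have hgm : AEStronglyMeasurable g (volume.restrict (uIoc a b)) :=
    (hg.mono uIoc_subset_uIcc).aestronglyMeasurable measurableSet_uIoc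
  refine Integrable.mono' (hf.norm.const_mul (‖L‖ * C))
    (L.continuous₂.comp_aestronglyMeasurable₂ hf.1 hgm) ?_
  filter_upwards [ae_restrict_mem measurableSet_uIoc] with s hs
  calc ‖L (f s) (g s)‖ ≤ ‖L‖ * ‖f s‖ * ‖g s‖ := L.le_opNorm₂ _ _
    _ ≤ ‖L‖ * ‖f s‖ * C := by gcongr; exact hC s (uIoc_subset_uIcc hs)
    _ = _ := by ring

/-- Chain rule for a symmetric bounded bilinear form along an absolutely continuous curve. -/
theorem quadratic_primitive (β : E →L[ℝ] E →L[ℝ] ℝ) (hβ : ∀ v w, β v w = β w v) {f : ℝ → E}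
    {a b : ℝ} (hab : a ≤ b) (hf : IntervalIntegrable f volume a b) (x₀ : E) :
    β (x₀ + ∫ s in a..b, f s) (x₀ + ∫ s in a..b, f s)
      = β x₀ x₀ + 2 * ∫ s in a..b, β (f s) (x₀ + ∫ r in a..s, f r) := by
  have hc : ContinuousOn (fun s => ∫ r in a..s, f r) (uIcc a b) :=
    intervalIntegral.continuousOn_primitive_interval' hf left_mem_uIcc
  have h1 := intervalIntegrable_bilin_of_continuousOn β hf hc
  have h0 : IntervalIntegrable (fun s => β (f s) x₀) volume a b :=
    intervalIntegrable_bilin_of_continuousOn β hf continuousOn_const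
  have key := integral_bilin_primitive β hab hf hf
  have e : ∫ s in a..b, β (∫ r in a..s, f r) (f s) = ∫ s in a..b, β (f s) (∫ r in a..s, f r) :=
    intervalIntegral.integral_congr fun s _ => hβ _ _
  have e0 : ∫ s in a..b, β (f s) x₀ = β (∫ s in a..b, f s) x₀ :=
    (β.flip x₀).intervalIntegral_comp_comm hf
  simp only [map_add, add_apply]
  rw [intervalIntegral.integral_add h0 h1, e0, hβ x₀ (∫ s in a..b, f s)]
  rw [e] at key
  linarith

omit [CompleteSpace E] in
theorem integral_timeMeasure_eq_intervalIntegral {T : ℝ} (hT : 0 ≤ T) (F : ℝ → E) :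
    ∫ t in Ioo 0 T, F t = ∫ t in (0 : ℝ)..T, F t := by
  rw [intervalIntegral.integral_of_le hT, integral_Ioc_eq_integral_Ioo]

omit [NormedSpace ℝ E] [CompleteSpace E] in
theorem intervalIntegrable_of_integrable_timeMeasure {T : ℝ} (hT : 0 ≤ T) {F : ℝ → E}
    (hF : Integrable F (timeMeasure T)) : IntervalIntegrable F volume 0 T := by
  rw [intervalIntegrable_iff_integrableOn_Ioo_of_le hT]
  exact hF

/-- A test function with vanishing integral is the derivative of a test function. -/
theorem exists_test_primitive {T : ℝ} (hT : 0 < T) {χ : ℝ → ℝ} (hχ : ContDiff ℝ ∞ χ)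
    (hc : HasCompactSupport χ) (hs : tsupport χ ⊆ Ioo 0 T) (h0 : ∫ t, χ t = 0) :
    ∃ φ : ℝ → ℝ, ContDiff ℝ ∞ φ ∧ HasCompactSupport φ ∧ tsupport φ ⊆ Ioo 0 T ∧ deriv φ = χ := by
  obtain ⟨a, b, ha, hb, hab⟩ : ∃ a b : ℝ, 0 < a ∧ b < T ∧ tsupport χ ⊆ Icc a b := by
    rcases (tsupport χ).eq_empty_or_nonempty with he | hne
    -- For empty support the reversed endpoints make `Icc` empty and still satisfy 0 < a and b < T.
    · exact ⟨T, 0, hT, hT, by simp [he]⟩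
    · obtain ⟨a, ha, ha'⟩ := hc.isCompact.exists_isLeast hne
      obtain ⟨b, hb, hb'⟩ := hc.isCompact.exists_isGreatest hne
      exact ⟨a, b, (hs ha).1, (hs hb).2, fun x hx => ⟨ha' hx, hb' hx⟩⟩
  have hz : ∀ t, t ∉ Icc a b → χ t = 0 := fun t ht => image_eq_zero_of_notMem_tsupport
    fun h => ht (hab h)
  have hd : deriv (fun t => ∫ s in (0 : ℝ)..t, χ s) = χ := by
    ext t; exact hχ.continuous.deriv_integral χ 0 t
  have hts : tsupport (fun t => ∫ s in (0 : ℝ)..t, χ s) ⊆ Icc a b := by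
    refine closure_minimal (fun t ht => ?_) isClosed_Icc
    by_contra hn
    refine ht ?_
    -- Left of a nothing has been integrated yet; right of b the whole integral of χ has, and it is
    -- zero.
    rw [mem_Icc, not_and_or, not_le, not_le] at hn
    rcases hn with hn | hn
    · refine (intervalIntegral.integral_congr (g := fun _ => 0) fun s hs' => hz s fun h => ?_).trans
        intervalIntegral.integral_zero
      have : s ≤ max 0 t := hs'.2
      exact absurd (h.1.trans this) (not_le.2 (max_lt ha hn))
    · refine (intervalIntegral.integral_eq_integral_of_support_subset ?_).trans h0
      intro s hs'
      have := hab (subset_tsupport _ hs')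
      exact ⟨ha.trans_le this.1, this.2.trans hn.le⟩
  refine ⟨fun t => ∫ s in (0 : ℝ)..t, χ s, ?_, ?_, ?_, hd⟩
  · rw [contDiff_infty_iff_deriv, hd]
    exact ⟨fun t => (hχ.continuous.integral_hasStrictDerivAt 0 t).hasDerivAt.differentiableAt, hχ⟩
  · exact isCompact_Icc.of_isClosed_subset (isClosed_tsupport _) hts
  · exact hts.trans fun x hx => ⟨ha.trans_le hx.1, hx.2.trans_lt hb⟩

/-- The lemma of du Bois-Reymond. -/
theorem exists_ae_eq_const_of_integral_deriv_smul_eq_zero {T : ℝ} (hT : 0 < T) {F : ℝ → E}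
    (hF : Integrable F (timeMeasure T))
    (h : ∀ φ : ℝ → ℝ, ContDiff ℝ ∞ φ → HasCompactSupport φ → tsupport φ ⊆ Ioo 0 T →
      ∫ t in Ioo 0 T, deriv φ t • F t = 0) :
    ∃ c : E, ∀ᵐ t ∂(timeMeasure T), F t = c := by
  -- A fixed weight η of integral one, supported in [T/4, 3T/4]; the constant sought is the
  -- η-weighted mean of F.
  let b : ContDiffBump (T / 2) := ⟨T / 8, T / 4, by positivity, by linarith⟩
  let η : ℝ → ℝ := b.normed volume
  have hη : ContDiff ℝ ∞ η := b.contDiff_normed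
  have hηc : HasCompactSupport η := b.hasCompactSupport_normed
  have hηs : tsupport η ⊆ Ioo 0 T := by
    rw [b.tsupport_normed_eq, Real.closedBall_eq_Icc]
    intro x hx
    have h1 : T / 2 - T / 4 ≤ x := hx.1
    have h2 : x ≤ T / 2 + T / 4 := hx.2
    constructor <;> linarith
  have hηi : ∫ t, η t = 1 := b.integral_normed
  have hsm : ∀ {ψ : ℝ → ℝ}, ContDiff ℝ ∞ ψ → HasCompactSupport ψ → ∀ {X : ℝ → E},
      Integrable X (timeMeasure T) → Integrable (fun t => ψ t • X t) (timeMeasure T) := by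
    intro ψ hψ hψc X hX
    obtain ⟨C, hC⟩ := hψc.exists_bound_of_continuous hψ.continuous
    exact hX.bdd_smul C hψ.continuous.aestronglyMeasurable (Eventually.of_forall hC)
  refine ⟨∫ t in Ioo 0 T, η t • F t, ?_⟩
  set c := ∫ t in Ioo 0 T, η t • F t with hc
  have hFc : Integrable (fun t => F t - c) (timeMeasure T) := hF.sub (integrable_const c)
  have key := isOpen_Ioo.ae_eq_zero_of_integral_contDiff_smul_eq_zero (μ := volume) (U := Ioo 0 T)
    (f := fun t => F t - c)
    (IntegrableOn.locallyIntegrableOn (s := Ioo 0 T) hFc) (fun ψ hψ hψc hψs => ?_)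
  · rw [ae_restrict_iff' measurableSet_Ioo]
    filter_upwards [key] with t ht hmem
    exact sub_eq_zero.1 (ht hmem)
  have hψi : Integrable ψ volume := hψ.continuous.integrable_of_hasCompactSupport hψc
  have hηint : Integrable η volume := hη.continuous.integrable_of_hasCompactSupport hηc
  have hzero : ∀ {ψ : ℝ → ℝ}, tsupport ψ ⊆ Ioo 0 T → ∀ x ∉ Ioo 0 T, ψ x = 0 :=
    fun hs x hx => image_eq_zero_of_notMem_tsupport fun h => hx (hs h)
  have hψI : ∫ t in Ioo 0 T, ψ t = ∫ t, ψ t :=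
    setIntegral_eq_integral_of_forall_compl_eq_zero (hzero hψs)
  -- Removing (∫ψ)η leaves mean zero, so the difference is the derivative of a test function and the
  -- hypothesis applies to it.
  obtain ⟨φ, hφ, hφc, hφs, hφd⟩ := exists_test_primitive hT
    (χ := fun t => ψ t - (∫ s, ψ s) * η t) (hψ.sub (contDiff_const.mul hη))
    (hψc.sub (hηc.mul_left)) (by
      refine (tsupport_sub _ _).trans (union_subset hψs ?_)
      exact (tsupport_mul_subset_right).trans hηs) (by
      rw [integral_sub hψi (hηint.const_mul _), integral_const_mul, hηi]; ring)
  have h1 := h φ hφ hφc hφs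
  rw [hφd] at h1
  simp only [sub_smul, mul_smul] at h1
  have hηF : Integrable (fun t => (∫ s, ψ s) • η t • F t) (timeMeasure T) :=
    (hsm hη hηc hF).smul (∫ s, ψ s)
  rw [integral_sub (hsm hψ hψc hF) hηF, integral_smul, ← hc] at h1
  rw [← setIntegral_eq_integral_of_forall_compl_eq_zero (s := Ioo 0 T)
    (fun x hx => by rw [hzero hψs x hx, zero_smul])]
  simp only [smul_sub]
  rw [integral_sub (hsm hψ hψc hF) (hsm hψ hψc (integrable_const c)), integral_smul_const, hψI]
  exact h1

/-- A function with integrable weak derivative is a.e. the primitive of that derivative. -/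
theorem exists_ae_eq_add_integral_of_weakDeriv {T : ℝ} (hT : 0 < T) {F f : ℝ → E}
    (hF : Integrable F (timeMeasure T)) (hf : Integrable f (timeMeasure T))
    (h : ∀ φ : ℝ → ℝ, ContDiff ℝ ∞ φ → HasCompactSupport φ → tsupport φ ⊆ Ioo 0 T →
      ∫ t in Ioo 0 T, deriv φ t • F t = - ∫ t in Ioo 0 T, φ t • f t) :
    ∃ c : E, ∀ᵐ t ∂(timeMeasure T), F t = c + ∫ s in (0 : ℝ)..t, f s := by
  have hfi := intervalIntegrable_of_integrable_timeMeasure hT.le hf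
  have hcont : ContinuousOn (fun t => ∫ s in (0 : ℝ)..t, f s) (uIcc 0 T) :=
    intervalIntegral.continuousOn_primitive_interval' hfi left_mem_uIcc
  have hΦ : Integrable (fun t => ∫ s in (0 : ℝ)..t, f s) (timeMeasure T) :=
    (hcont.integrableOn_compact isCompact_uIcc).mono_set
      (Ioo_subset_Icc_self.trans Icc_subset_uIcc)
  suffices hs : ∀ φ : ℝ → ℝ, ContDiff ℝ ∞ φ → HasCompactSupport φ → tsupport φ ⊆ Ioo 0 T →
      ∫ t in Ioo 0 T, deriv φ t • (F t - ∫ s in (0 : ℝ)..t, f s) = 0 by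
    obtain ⟨c, hc⟩ := exists_ae_eq_const_of_integral_deriv_smul_eq_zero hT (hF.sub hΦ) hs
    refine ⟨c, ?_⟩
    filter_upwards [hc] with t ht
    rw [← ht]; simp
  intro φ hφ hφc hφs
  have hφd : Continuous (deriv φ) := hφ.continuous_deriv (by simp)
  have hsm : ∀ {X : ℝ → E}, Integrable X (timeMeasure T) →
      Integrable (fun t => deriv φ t • X t) (timeMeasure T) := by
    intro X hX
    obtain ⟨C, hC⟩ := hφc.deriv.exists_bound_of_continuous hφd
    exact hX.bdd_smul C hφd.aestronglyMeasurable (Eventually.of_forall hC)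
  have hφz : ∀ x ∉ Ioo 0 T, φ x = 0 :=
    fun x hx => image_eq_zero_of_notMem_tsupport fun h => hx (hφs h)
  have hprim : ∀ t, ∫ s in (0 : ℝ)..t, deriv φ s = φ t := by
    intro t
    rw [intervalIntegral.integral_deriv_eq_sub
      (fun x _ => (hφ.differentiable (by simp)).differentiableAt)
      (hφd.intervalIntegrable _ _), hφz 0 (by simp), sub_zero]
  -- Integration by parts of φ against the primitive of f: the boundary term vanishes with φ(T), so
  -- F and this primitive have the same weak derivative.
  have key := integral_bilin_primitive (ContinuousLinearMap.lsmul ℝ ℝ : ℝ →L[ℝ] E →L[ℝ] E)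
    hT.le (hφd.intervalIntegrable 0 T) hfi
  simp only [ContinuousLinearMap.lsmul_apply, hprim, hφz T (by simp), zero_smul] at key
  simp only [smul_sub]
  rw [integral_sub (hsm hF) (hsm hΦ), h φ hφ hφc hφs]
  simp only [integral_timeMeasure_eq_intervalIntegral hT.le]
  rw [← neg_add', neg_eq_zero, add_comm]
  exact key

end Primitives

/-! ### Resolvents of ι*ι as smoothing operators -/

section Resolvent

variable {V H : Type*} [NormedAddCommGroup V] [InnerProductSpace ℝ V] [CompleteSpace V]
  [NormedAddCommGroup H] [InnerProductSpace ℝ H] [CompleteSpace H]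

/-- The operator `ι* ι` on `V`. -/
def gramOp (ι : V →L[ℝ] H) : V →L[ℝ] V := ι.adjoint ∘L ι

theorem gramOp_apply (ι : V →L[ℝ] H) (v : V) : gramOp ι v = ι.adjoint (ι v) := rfl

theorem inner_gramOp_left (ι : V →L[ℝ] H) (v w : V) :
    inner ℝ (gramOp ι v) w = inner ℝ (ι v) (ι w) := ι.adjoint_inner_left w (ι v)

/-- A vector v orthogonal to the range is orthogonal to ι*ι v, that is ‖ι v‖ = 0, and ι is
injective. -/
theorem denseRange_gramOp {ι : V →L[ℝ] H} (hι : Function.Injective ι) :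
    DenseRange (gramOp ι) := by
  have h : (LinearMap.range (gramOp ι : V →ₗ[ℝ] V))ᗮ = ⊥ := by
    rw [Submodule.eq_bot_iff]
    intro v hv
    have := (Submodule.mem_orthogonal _ _).1 hv (gramOp ι v) ⟨v, rfl⟩
    rw [inner_gramOp_left, inner_self_eq_zero] at this
    exact hι (this.trans (map_zero ι).symm)
  have h2 := (Submodule.topologicalClosure_eq_top_iff).2 h
  rw [← Submodule.dense_iff_topologicalClosure_eq_top] at h2
  exact h2

/-- The resolvent `(ι* ι + ε)⁻¹`, `ε > 0`, of the positive operator `ι* ι`. -/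
theorem exists_gramOp_resolvent (ι : V →L[ℝ] H) {ε : ℝ} (hε : 0 < ε) :
    ∃ R : V →L[ℝ] V, (∀ v, gramOp ι (R v) + ε • R v = v) ∧
      ∀ v, R (gramOp ι v + ε • v) = v := by
  let b : V →L[ℝ] V →L[ℝ] ℝ :=
    (innerSL ℝ : V →L[ℝ] V →L[ℝ] ℝ).comp (gramOp ι + ε • ContinuousLinearMap.id ℝ V)
  have hb : ∀ v w, b v w = inner ℝ (gramOp ι v + ε • v) w := fun v w => rfl
  have hco : IsCoercive b := by
    refine ⟨ε, hε, fun v => ?_⟩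
    rw [hb, inner_add_left, inner_gramOp_left, real_inner_smul_left, real_inner_self_eq_norm_sq,
      real_inner_self_eq_norm_sq]
    nlinarith [sq_nonneg ‖ι v‖]
  have he : ∀ v, hco.continuousLinearEquivOfBilin v = gramOp ι v + ε • v := by
    intro v
    refine ext_inner_right ℝ fun w => ?_
    rw [hco.continuousLinearEquivOfBilin_apply, hb]
  refine ⟨hco.continuousLinearEquivOfBilin.symm, fun v => ?_, fun v => ?_⟩
  · rw [ContinuousLinearEquiv.coe_coe, ← he, ContinuousLinearEquiv.apply_symm_apply]
  · rw [ContinuousLinearEquiv.coe_coe, ← he, ContinuousLinearEquiv.symm_apply_apply]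

/-- Bounded operators `R n` commuting with `ι* ι` such that `ι* ι (R n)` is a sequence of
contractions converging strongly to the identity. -/
theorem exists_gramOp_approx_inverse {ι : V →L[ℝ] H} (hι : Function.Injective ι) :
    ∃ R : ℕ → V →L[ℝ] V, (∀ n v, R n (gramOp ι v) = gramOp ι (R n v)) ∧
      (∀ n v, ‖gramOp ι (R n v)‖ ≤ ‖v‖) ∧
      ∀ v, Tendsto (fun n => gramOp ι (R n v)) atTop (𝓝 v) := by
  have hpos : ∀ n : ℕ, (0 : ℝ) < 1 / ((n : ℝ) + 1) := fun n => by positivity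
  choose R hR1 hR2 using fun n : ℕ => exists_gramOp_resolvent ι (hpos n)
  have hcomm : ∀ (n : ℕ) v, R n (gramOp ι v) = gramOp ι (R n v) := by
    intro n v
    conv_lhs => rw [← hR1 n v]
    rw [map_add (gramOp ι), map_smul (gramOp ι), hR2]
  -- Pairing the resolvent equation with εRv and dropping ε‖ιRv‖² ≥ 0. This one inequality makes
  -- both εR and 1 − εR = ι*ι R contractions.
  have hest : ∀ (n : ℕ) v, ‖(1 / ((n : ℝ) + 1)) • R n v‖ ^ 2
      ≤ inner ℝ v ((1 / ((n : ℝ) + 1)) • R n v) := by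
    intro n v
    set ε := 1 / ((n : ℝ) + 1) with hε
    have h1 : inner ℝ v (ε • R n v) = inner ℝ (gramOp ι (R n v)) (ε • R n v)
        + inner ℝ (ε • R n v) (ε • R n v) := by
      rw [← inner_add_left, hR1]
    rw [h1, inner_gramOp_left, map_smul, real_inner_smul_right, real_inner_self_eq_norm_sq,
      real_inner_self_eq_norm_sq]
    have := mul_nonneg (hpos n).le (sq_nonneg ‖ι (R n v)‖)
    linarith
  have hle1 : ∀ (n : ℕ) v, ‖(1 / ((n : ℝ) + 1)) • R n v‖ ≤ ‖v‖ := by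
    intro n v
    have h1 := hest n v
    have h2 := real_inner_le_norm v ((1 / ((n : ℝ) + 1)) • R n v)
    rcases (norm_nonneg ((1 / ((n : ℝ) + 1)) • R n v)).eq_or_lt with h | h
    · rw [← h]; exact norm_nonneg v
    · nlinarith
  have hsub : ∀ (n : ℕ) v, gramOp ι (R n v) = v - (1 / ((n : ℝ) + 1)) • R n v :=
    fun n v => eq_sub_of_add_eq (hR1 n v)
  have hle2 : ∀ (n : ℕ) v, ‖gramOp ι (R n v)‖ ≤ ‖v‖ := by
    intro n v
    rw [hsub]
    refine le_of_sq_le_sq ?_ (norm_nonneg _)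
    rw [norm_sub_sq_real]
    linarith [hest n v, sq_nonneg ‖(1 / ((n : ℝ) + 1)) • R n v‖]
  refine ⟨R, hcomm, hle2, fun v => ?_⟩
  rw [Metric.tendsto_atTop]
  intro δ hδ
  -- It remains to see εRv → 0. On the dense range of ι*ι this is explicit, since εR(ι*ι z) = ε(ι*ι
  -- R z) has norm at most ε‖z‖; the error v − ι*ι z is handled by contractivity of εR.
  obtain ⟨z, hz⟩ := (denseRange_gramOp hι).exists_dist_lt v (half_pos hδ)
  obtain ⟨N, hN⟩ := exists_nat_gt (2 * ‖z‖ / δ)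
  refine ⟨N, fun n hn => ?_⟩
  rw [dist_eq_norm, hsub, sub_sub_cancel_left, norm_neg]
  have hsplit : (1 / ((n : ℝ) + 1)) • R n v = (1 / ((n : ℝ) + 1)) • R n (v - gramOp ι z)
      + (1 / ((n : ℝ) + 1)) • gramOp ι (R n z) := by
    rw [← hcomm, ← smul_add, ← map_add, sub_add_cancel]
  rw [hsplit]
  have hn' : 2 * ‖z‖ / δ < (n : ℝ) + 1 := by
    have : (N : ℝ) ≤ n := by exact_mod_cast hn
    linarith
  have h3 : ‖(1 / ((n : ℝ) + 1)) • gramOp ι (R n z)‖ < δ / 2 := by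
    rw [norm_smul, Real.norm_of_nonneg (hpos n).le, one_div, inv_mul_lt_iff₀ (by positivity)]
    rw [div_lt_iff₀ hδ] at hn'
    have := hle2 n z
    linarith
  calc _ ≤ ‖(1 / ((n : ℝ) + 1)) • R n (v - gramOp ι z)‖
        + ‖(1 / ((n : ℝ) + 1)) • gramOp ι (R n z)‖ := norm_add_le _ _
    _ < δ / 2 + δ / 2 := by
        refine add_lt_add ((hle1 n _).trans_lt ?_) h3
        rwa [← dist_eq_norm]
    _ = δ := by ring

end Resolvent

/-! ### Continuous representatives and the energy identity -/

section ContinuousRepresentative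

variable {V H : Type*} [NormedAddCommGroup V] [InnerProductSpace ℝ V] [CompleteSpace V]
  [NormedAddCommGroup H] [InnerProductSpace ℝ H] [CompleteSpace H]

theorem integrable_norm_mul_norm {α E F : Type*} [MeasurableSpace α] {μ : Measure α}
    [NormedAddCommGroup E] [NormedAddCommGroup F] {f : α → E} {g : α → F} (hf : MemLp f 2 μ)
    (hg : MemLp g 2 μ) : Integrable (fun t => ‖f t‖ * ‖g t‖) μ :=
  hf.norm.integrable_mul hg.norm

-- Dominated convergence with majorant 2‖f‖‖y‖. This integral is the defect that bounds the Cauchy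
-- differences of the regularised curves.
omit [CompleteSpace V] in
theorem tendsto_integral_norm_mul_norm_sub {μ : Measure ℝ} {f y : ℝ → V}
    (hf : MemLp f 2 μ) (hy : MemLp y 2 μ) {S : ℕ → V →L[ℝ] V} (hS : ∀ n v, ‖S n v‖ ≤ ‖v‖)
    (hS' : ∀ v, Tendsto (fun n => S n v) atTop (𝓝 v)) :
    Tendsto (fun n => ∫ t, ‖f t‖ * ‖S n (y t) - y t‖ ∂μ) atTop (𝓝 0) := by
  have h := tendsto_integral_of_dominated_convergence (μ := μ)
    (F := fun n t => ‖f t‖ * ‖S n (y t) - y t‖) (f := fun _ => 0)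
    (fun t => 2 * (‖f t‖ * ‖y t‖)) (fun n => ?_) ((integrable_norm_mul_norm hf hy).const_mul 2)
    (fun n => Eventually.of_forall fun t => ?_) (Eventually.of_forall fun t => ?_)
  · simpa using h
  · exact hf.1.norm.mul (((S n).continuous.comp_aestronglyMeasurable hy.1).sub hy.1).norm
  · rw [Real.norm_of_nonneg (by positivity)]
    have : ‖S n (y t) - y t‖ ≤ 2 * ‖y t‖ := (norm_sub_le _ _).trans (by linarith [hS n (y t)])
    nlinarith [norm_nonneg (f t)]
  · have h1 : Tendsto (fun n => ‖S n (y t) - y t‖) atTop (𝓝 0) := by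
      simpa using ((hS' (y t)).sub_const (y t)).norm
    simpa using h1.const_mul ‖f t‖

-- Strong convergence in both slots, with majorant ‖f‖‖y‖; it passes the regularised energy identity
-- to the limit.
omit [CompleteSpace V] in
theorem tendsto_integral_inner_of_strong {μ : Measure ℝ} {f y : ℝ → V}
    (hf : MemLp f 2 μ) (hy : MemLp y 2 μ) {S : ℕ → V →L[ℝ] V} (hS : ∀ n v, ‖S n v‖ ≤ ‖v‖)
    (hS' : ∀ v, Tendsto (fun n => S n v) atTop (𝓝 v)) :
    Tendsto (fun n => ∫ t, inner ℝ (S n (f t)) (S n (y t)) ∂μ) atTop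
      (𝓝 (∫ t, inner ℝ (f t) (y t) ∂μ)) := by
  refine tendsto_integral_of_dominated_convergence (fun t => ‖f t‖ * ‖y t‖) (fun n => ?_)
    (integrable_norm_mul_norm hf hy)
    (fun n => Eventually.of_forall fun t => ?_) (Eventually.of_forall fun t => ?_)
  · exact ((S n).continuous.comp_aestronglyMeasurable hf.1).inner
      ((S n).continuous.comp_aestronglyMeasurable hy.1)
  · exact (norm_inner_le_norm _ _).trans (mul_le_mul (hS _ _) (hS _ _) (norm_nonneg _)
      (norm_nonneg _))
  · exact (hS' (f t)).inner (hS' (y t))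

/-- If `ι* ι y` is a.e. a primitive of `f ∈ L²(0,T;V)`, then `ι y` has a continuous representative
`u : [0,T] → H`, and `d/dt ‖u‖² = 2 (f, y)`. -/
theorem exists_continuousOn_rep {ι : V →L[ℝ] H} (hι : Function.Injective ι) {T : ℝ} (hT : 0 < T)
    {y f : ℝ → V} (hy : MemLp y 2 (timeMeasure T)) (hf : MemLp f 2 (timeMeasure T)) {x₀ : V}
    (hx : ∀ᵐ t ∂(timeMeasure T), gramOp ι (y t) = x₀ + ∫ s in (0 : ℝ)..t, f s) :
    ∃ u : ℝ → H, ContinuousOn u (Icc 0 T) ∧ (∀ᵐ t ∂(timeMeasure T), u t = ι (y t)) ∧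
      (∀ t ∈ Icc 0 T, ι.adjoint (u t) = x₀ + ∫ s in (0 : ℝ)..t, f s) ∧
      ∀ t ∈ Icc 0 T, ‖u t‖ ^ 2 = ‖u 0‖ ^ 2 + 2 * ∫ s in (0 : ℝ)..t, inner ℝ (f s) (y s) := by
  obtain ⟨R, hcomm, hcon, hlim⟩ := exists_gramOp_approx_inverse hι
  have hfi : IntervalIntegrable f volume 0 T :=
    intervalIntegrable_of_integrable_timeMeasure hT.le (hf.integrable one_le_two)
  have hsubI : ∀ {s t : ℝ}, s ∈ Icc 0 T → t ∈ Icc 0 T → IntervalIntegrable f volume s t := by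
    intro s t hs ht
    refine hfi.mono_set ?_
    rw [uIcc_of_le hT.le]
    exact (convex_Icc 0 T).ordConnected.uIcc_subset hs ht
  have h0mem : (0 : ℝ) ∈ Icc 0 T := ⟨le_rfl, hT.le⟩
  set x : ℝ → V := fun t => x₀ + ∫ s in (0 : ℝ)..t, f s with hxdef
  have hxc : ContinuousOn x (Icc 0 T) := by
    have := intervalIntegral.continuousOn_primitive_interval' hfi left_mem_uIcc
    rw [uIcc_of_le hT.le] at this
    exact continuousOn_const.add this
  have hxst : ∀ {s t : ℝ}, s ∈ Icc 0 T → t ∈ Icc 0 T → x t = x s + ∫ r in s..t, f r := by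
    intro s t hs ht
    rw [hxdef]
    dsimp only
    rw [add_assoc, intervalIntegral.integral_add_adjacent_intervals (hsubI h0mem hs) (hsubI hs ht)]
  -- the chain rule for `‖ι D x‖²`
  have hquad : ∀ D : V →L[ℝ] V, (∀ v, D (gramOp ι v) = gramOp ι (D v)) →
      ∀ {s t : ℝ}, s ∈ Icc 0 T → t ∈ Icc 0 T → s ≤ t → ‖ι (D (x t))‖ ^ 2 = ‖ι (D (x s))‖ ^ 2
        + 2 * ∫ r in s..t, inner ℝ (gramOp ι (D (f r))) (gramOp ι (D (y r))) := by
    intro D hD s t hs ht hst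
    let β : V →L[ℝ] V →L[ℝ] ℝ := (innerSL ℝ : H →L[ℝ] H →L[ℝ] ℝ).bilinearComp (ι ∘L D) (ι ∘L D)
    have hβ : ∀ v w, β v w = inner ℝ (ι (D v)) (ι (D w)) := fun v w => rfl
    have key := quadratic_primitive β (fun v w => real_inner_comm _ _) hst (hsubI hs ht) (x s)
    rw [← hxst hs ht] at key
    rw [hβ, hβ, real_inner_self_eq_norm_sq, real_inner_self_eq_norm_sq] at key
    rw [key]
    congr 2
    -- Almost everywhere x = ι*ι y. Commuting D past ι*ι frees a factor ι*ι, and moving ι across the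
    -- inner product places ι*ι D on both f and y, which stays bounded for D = R_n.
    refine intervalIntegral.integral_congr_ae ?_
    rw [ae_restrict_iff' measurableSet_Ioo] at hx
    filter_upwards [hx, (show ∀ᵐ r : ℝ, r ≠ T from Measure.ae_ne volume T)] with r hr hrT hmem
    rw [uIoc_of_le hst] at hmem
    have hr0 : r ∈ Icc 0 T := ⟨hs.1.trans hmem.1.le, hmem.2.trans ht.2⟩
    rw [← hxst hs hr0, hβ]
    have : x r = gramOp ι (y r) :=
      (hr ⟨hs.1.trans_lt hmem.1, lt_of_le_of_ne hr0.2 hrT⟩).symm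
    rw [this, hD, ← inner_gramOp_left, gramOp_apply ι (D (f r))]
  have hsubm : ∀ {s t : ℝ}, s ∈ Icc 0 T → t ∈ Icc 0 T →
      volume.restrict (Ioc s t) ≤ timeMeasure T := by
    intro s t hs ht
    rw [timeMeasure, restrict_Ioo_eq_restrict_Ioc]
    exact Measure.restrict_mono (Ioc_subset_Ioc hs.1 ht.2) le_rfl
  -- Cauchy estimate
  let a : ℕ → ℝ := fun n => ∫ r in Ioo 0 T, ‖f r‖ * ‖gramOp ι (R n (y r)) - y r‖
  have ha : Tendsto a atTop (𝓝 0) :=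
    tendsto_integral_norm_mul_norm_sub hf hy (S := fun n => gramOp ι ∘L R n) hcon hlim
  have haI : ∀ n, Integrable (fun r => ‖f r‖ * ‖gramOp ι (R n (y r)) - y r‖) (timeMeasure T) :=
    fun n => integrable_norm_mul_norm hf (((gramOp ι ∘L R n).comp_memLp' hy).sub hy)
  have hJ : ∀ n m {s t : ℝ}, s ∈ Icc 0 T → t ∈ Icc 0 T → s ≤ t →
      |∫ r in s..t, inner ℝ (gramOp ι ((R n - R m) (f r))) (gramOp ι ((R n - R m) (y r)))|
        ≤ 2 * (a n + a m) := by
    intro n m s t hs ht hst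
    rw [← Real.norm_eq_abs, intervalIntegral.integral_of_le hst]
    have hI : Integrable (fun r => 2 * (‖f r‖ * ‖gramOp ι (R n (y r)) - y r‖
        + ‖f r‖ * ‖gramOp ι (R m (y r)) - y r‖)) (timeMeasure T) :=
      ((haI n).add (haI m)).const_mul 2
    calc _ ≤ ∫ r in Ioc s t, 2 * (‖f r‖ * ‖gramOp ι (R n (y r)) - y r‖
            + ‖f r‖ * ‖gramOp ι (R m (y r)) - y r‖) := by
          refine norm_integral_le_of_norm_le (hI.mono_measure (hsubm hs ht))
            (Eventually.of_forall fun r => ?_)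
          have h1 : ‖gramOp ι ((R n - R m) (f r))‖ ≤ 2 * ‖f r‖ := by
            rw [sub_apply, map_sub]
            exact (norm_sub_le _ _).trans (by linarith [hcon n (f r), hcon m (f r)])
          have h2 : ‖gramOp ι ((R n - R m) (y r))‖ ≤ ‖gramOp ι (R n (y r)) - y r‖
              + ‖gramOp ι (R m (y r)) - y r‖ := by
            rw [sub_apply, map_sub]
            have e : gramOp ι (R n (y r)) - gramOp ι (R m (y r))
                = (gramOp ι (R n (y r)) - y r) - (gramOp ι (R m (y r)) - y r) := by abel
            rw [e]
            exact norm_sub_le _ _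
          calc _ ≤ ‖gramOp ι ((R n - R m) (f r))‖ * ‖gramOp ι ((R n - R m) (y r))‖ :=
                norm_inner_le_norm _ _
            _ ≤ (2 * ‖f r‖) * (‖gramOp ι (R n (y r)) - y r‖ + ‖gramOp ι (R m (y r)) - y r‖) :=
                mul_le_mul h1 h2 (norm_nonneg _) (by positivity)
            _ = _ := by ring
      _ ≤ ∫ r in Ioo 0 T, 2 * (‖f r‖ * ‖gramOp ι (R n (y r)) - y r‖
            + ‖f r‖ * ‖gramOp ι (R m (y r)) - y r‖) :=
          integral_mono_measure (hsubm hs ht) (Eventually.of_forall fun r => by positivity) hI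
      _ = _ := by rw [integral_const_mul, integral_add (haI n) (haI m)]
  have hD : ∀ n m v, (R n - R m) (gramOp ι v) = gramOp ι ((R n - R m) v) := by
    intro n m v
    rw [sub_apply, sub_apply, map_sub, hcomm, hcomm]
  -- The order of s and t is irrelevant, so smallness of the difference at one point spreads
  -- uniformly over [0,T].
  have hest : ∀ n m {s t : ℝ}, s ∈ Icc 0 T → t ∈ Icc 0 T →
      ‖ι (R n (x t)) - ι (R m (x t))‖ ^ 2 ≤ ‖ι (R n (x s)) - ι (R m (x s))‖ ^ 2
        + 4 * (a n + a m) := by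
    intro n m s t hs ht
    have e : ∀ τ, ι (R n (x τ)) - ι (R m (x τ)) = ι ((R n - R m) (x τ)) := by
      intro τ; rw [sub_apply, map_sub]
    rw [e, e]
    rcases le_total s t with hst | hst
    · have h1 := hquad (R n - R m) (hD n m) hs ht hst
      have h2 := (abs_le.1 (hJ n m hs ht hst)).2
      linarith
    · have h1 := hquad (R n - R m) (hD n m) ht hs hst
      have h2 := (abs_le.1 (hJ n m ht hs hst)).1
      linarith
  -- a point at which the sequence converges
  obtain ⟨s₀, hs₀, hs₀x⟩ : ∃ s₀ ∈ Icc 0 T, gramOp ι (y s₀) = x s₀ := by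
    have hne : NeBot (ae (timeMeasure T)) := by
      rw [ae_neBot, Ne, Measure.restrict_eq_zero, Real.volume_Ioo]
      simpa using hT
    obtain ⟨s, h1, h2⟩ := (hx.and (ae_restrict_mem measurableSet_Ioo)).exists
    exact ⟨s, Ioo_subset_Icc_self h2, h1⟩
  -- At such t, R_n x(t) = ι*ι R_n y(t) → y(t) in V.
  have hptlim : ∀ t, gramOp ι (y t) = x t →
      Tendsto (fun n => ι (R n (x t))) atTop (𝓝 (ι (y t))) := by
    intro t ht
    rw [← ht]
    simp only [hcomm]
    exact (ι.continuous.tendsto _).comp (hlim (y t))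
  have hcauchy : UniformCauchySeqOn (fun n t => ι (R n (x t))) atTop (Icc 0 T) := by
    rw [Metric.uniformCauchySeqOn_iff]
    intro ε hε
    have hc := Metric.cauchySeq_iff.1 (hptlim s₀ hs₀x).cauchySeq (ε / 2) (half_pos hε)
    obtain ⟨N1, hN1⟩ := hc
    -- The budget is (ε/2)² from the point s₀ plus 4·2·ε²/16 from the defects, in total 3ε²/4 < ε².
    obtain ⟨N2, hN2⟩ := (ha.eventually (gt_mem_nhds
      (show (0 : ℝ) < ε ^ 2 / 16 by positivity))).exists_forall_of_atTop
    refine ⟨max N1 N2, fun m hm n hn t ht => ?_⟩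
    have h1 := hest m n hs₀ ht
    have h2 := hN1 m (le_of_max_le_left hm) n (le_of_max_le_left hn)
    have h3 := hN2 m (le_of_max_le_right hm)
    have h4 := hN2 n (le_of_max_le_right hn)
    rw [dist_eq_norm] at h2 ⊢
    have h5 := norm_nonneg (ι (R m (x s₀)) - ι (R n (x s₀)))
    refine lt_of_pow_lt_pow_left₀ 2 hε.le ?_
    nlinarith
  have hex : ∀ t, ∃ h : H, t ∈ Icc 0 T → Tendsto (fun n => ι (R n (x t))) atTop (𝓝 h) := by
    intro t
    by_cases ht : t ∈ Icc 0 T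
    · obtain ⟨h, hh⟩ := cauchySeq_tendsto_of_complete (hcauchy.cauchySeq ht)
      exact ⟨h, fun _ => hh⟩
    · exact ⟨0, fun h => absurd h ht⟩
  choose u hu using hex
  have hunif := hcauchy.tendstoUniformlyOn_of_tendsto hu
  refine ⟨u, ?_, ?_, fun t ht => ?_, fun t ht => ?_⟩
  · refine hunif.continuousOn (Frequently.of_forall fun n => ?_)
    exact (ι ∘L R n).continuous.comp_continuousOn hxc
  · filter_upwards [hx, ae_restrict_mem measurableSet_Ioo] with t ht hmem
    exact tendsto_nhds_unique (hu t (Ioo_subset_Icc_self hmem)) (hptlim t ht)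
  · refine tendsto_nhds_unique ((ι.adjoint.continuous.tendsto _).comp (hu t ht)) ?_
    exact hlim (x t)
  · have hsub := hsubm h0mem ht
    have h1 := tendsto_integral_inner_of_strong (hf.mono_measure hsub) (hy.mono_measure hsub)
      (S := fun n => gramOp ι ∘L R n) hcon hlim
    have h2 : Tendsto (fun n => ‖ι (R n (x t))‖ ^ 2) atTop (𝓝 (‖u t‖ ^ 2)) := (hu t ht).norm.pow 2
    have h3 : Tendsto (fun n => ‖ι (R n (x 0))‖ ^ 2) atTop (𝓝 (‖u 0‖ ^ 2)) :=
      (hu 0 h0mem).norm.pow 2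
    rw [intervalIntegral.integral_of_le ht.1]
    refine tendsto_nhds_unique h2 ((h3.add (h1.const_mul 2)).congr fun n => ?_)
    rw [hquad (R n) (hcomm n) h0mem ht ht.1, intervalIntegral.integral_of_le ht.1]
    rfl

end ContinuousRepresentative

/-! ### Pointwise operators, separated functions and time reversal on L²(0,T;X) -/

section L2

variable {T : ℝ} {X Y Z : Type*} [NormedAddCommGroup X] [NormedSpace ℝ X]
  [NormedAddCommGroup Y] [NormedSpace ℝ Y] [NormedAddCommGroup Z] [NormedSpace ℝ Z]

theorem compLp_comp (L : Y →L[ℝ] Z) (M : X →L[ℝ] Y) (f : L2T T X) :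
    (L ∘L M).compLp f = L.compLp (M.compLp f) := by
  refine Lp.ext ?_
  filter_upwards [(L ∘L M).coeFn_compLp f, L.coeFn_compLp (M.compLp f), M.coeFn_compLp f]
    with t h1 h2 h3
  rw [h1, h2, h3]; rfl

theorem norm_compLp_of_isometry (L : X →L[ℝ] Y) (hL : ∀ x, ‖L x‖ = ‖x‖) (f : L2T T X) :
    ‖L.compLp f‖ = ‖f‖ := by
  rw [Lp.norm_def, Lp.norm_def]
  congr 1
  refine eLpNorm_congr_norm_ae ?_
  filter_upwards [L.coeFn_compLp f] with t ht
  rw [ht, hL]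

theorem compLp_linear_add (L : X →L[ℝ] Y) (f g : L2T T X) :
    L.compLp (f + g) = L.compLp f + L.compLp g := (L.compLpL 2 (timeMeasure T)).map_add f g

omit [NormedSpace ℝ X] in
theorem integrable_L2T (f : L2T T X) : Integrable (fun t => f t) (timeMeasure T) :=
  (Lp.memLp f).integrable one_le_two

/-- The endpoint T is null; `Ioc` is the form in which interval integrals ask for a.e. statements.
-/
theorem ae_timeMeasure_iff {p : ℝ → Prop} :
    (∀ᵐ t ∂(timeMeasure T), p t) ↔ ∀ᵐ t : ℝ, t ∈ Ioc 0 T → p t := by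
  rw [timeMeasure, restrict_Ioo_eq_restrict_Ioc, ae_restrict_iff' measurableSet_Ioc]

omit [NormedSpace ℝ X] in
theorem integrableOn_Ioc_iff_timeMeasure {F : ℝ → X} :
    IntegrableOn F (Ioc 0 T) ↔ Integrable F (timeMeasure T) := by
  rw [timeMeasure, restrict_Ioo_eq_restrict_Ioc]; rfl

theorem norm_sq_L2T_eq_integral {E : Type*} [NormedAddCommGroup E] [InnerProductSpace ℝ E]
    (f : L2T T E) : ‖f‖ ^ 2 = ∫ t in Ioo 0 T, ‖f t‖ ^ 2 := by
  rw [← real_inner_self_eq_norm_sq, L2.inner_def]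
  simp only [real_inner_self_eq_norm_sq]

theorem integrable_norm_sq_L2T {E : Type*} [NormedAddCommGroup E] (f : L2T T E) :
    Integrable (fun t => ‖f t‖ ^ 2) (timeMeasure T) := (Lp.memLp f).norm.integrable_sq

/-- The element `ψ v` of `L²(0,T;X)` for continuous `ψ : ℝ → ℝ` and `v ∈ X`. -/
def smulL2 (T : ℝ) {ψ : ℝ → ℝ} (hψ : Continuous ψ) (v : X) : L2T T X :=
  MemLp.toLp (fun t => ψ t • v) (by
    obtain ⟨C, hC⟩ := (isCompact_Icc (a := (0 : ℝ)) (b := T)).exists_bound_of_continuousOn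
      (f := fun t => ψ t • v) (by fun_prop)
    refine MemLp.of_bound (Continuous.aestronglyMeasurable (by fun_prop)) C ?_
    filter_upwards [ae_restrict_mem measurableSet_Ioo] with t ht
    exact hC t (Ioo_subset_Icc_self ht))

theorem coeFn_smulL2 {ψ : ℝ → ℝ} (hψ : Continuous ψ) (v : X) :
    ∀ᵐ t ∂(timeMeasure T), smulL2 T hψ v t = ψ t • v := MemLp.coeFn_toLp _

theorem compLp_smulL2 (L : X →L[ℝ] Y) {ψ : ℝ → ℝ} (hψ : Continuous ψ) (v : X) :
    L.compLp (smulL2 T hψ v) = smulL2 T hψ (L v) := by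
  refine Lp.ext ?_
  filter_upwards [L.coeFn_compLp (smulL2 T hψ v), coeFn_smulL2 hψ v, coeFn_smulL2 hψ (L v)]
    with t h1 h2 h3
  rw [h1, h2, h3, map_smul]

theorem inner_smulL2 {E : Type*} [NormedAddCommGroup E] [InnerProductSpace ℝ E] {ψ : ℝ → ℝ}
    (hψ : Continuous ψ) (v : E) (f : L2T T E) :
    inner ℝ (smulL2 T hψ v) f = ∫ t in Ioo 0 T, ψ t * inner ℝ v (f t) := by
  rw [L2.inner_def]
  refine integral_congr_ae ?_
  filter_upwards [coeFn_smulL2 hψ v] with t h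
  rw [h, real_inner_smul_left]

theorem integral_smul_smulL2 [CompleteSpace Y] (L : X →L[ℝ] Y) (φ : ℝ → ℝ) {ψ : ℝ → ℝ}
    (hψ : Continuous ψ) (v : X) :
    ∫ t in Ioo 0 T, φ t • L (smulL2 T hψ v t) = (∫ t in Ioo 0 T, φ t * ψ t) • L v := by
  rw [← integral_smul_const]
  refine integral_congr_ae ?_
  filter_upwards [coeFn_smulL2 hψ v] with t ht
  rw [ht, map_smul, smul_smul]

/-- The reflection `t ↦ T - t` preserves Lebesgue measure on `(0,T)`. -/
theorem measurePreserving_reflect (T : ℝ) :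
    MeasurePreserving (fun t : ℝ => T - t) (timeMeasure T) (timeMeasure T) := by
  have h := (Measure.measurePreserving_sub_left (volume : Measure ℝ) T).restrict_preimage
    (s := Ioo 0 T) measurableSet_Ioo
  have e : (fun t : ℝ => T - t) ⁻¹' Ioo 0 T = Ioo 0 T := by
    ext t
    simp only [mem_preimage, mem_Ioo]
    constructor <;> rintro ⟨h1, h2⟩ <;> constructor <;> linarith
  rwa [e] at h

/-- Time reversal on `L²(0,T;X)`. -/
def reflectL2 (T : ℝ) (X : Type*) [NormedAddCommGroup X] [NormedSpace ℝ X] :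
    L2T T X →ₗᵢ[ℝ] L2T T X :=
  Lp.compMeasurePreservingₗᵢ ℝ (fun t : ℝ => T - t) (measurePreserving_reflect T)

theorem coeFn_reflectL2 (f : L2T T X) : ∀ᵐ t ∂(timeMeasure T), reflectL2 T X f t = f (T - t) :=
  Lp.coeFn_compMeasurePreserving f (measurePreserving_reflect T)

omit [NormedSpace ℝ X] in
theorem ae_reflect {p : ℝ → Prop} (h : ∀ᵐ t ∂(timeMeasure T), p t) :
    ∀ᵐ t ∂(timeMeasure T), p (T - t) :=
  (measurePreserving_reflect T).quasiMeasurePreserving.ae h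

theorem reflectL2_reflectL2 (f : L2T T X) : reflectL2 T X (reflectL2 T X f) = f := by
  refine Lp.ext ?_
  filter_upwards [coeFn_reflectL2 (reflectL2 T X f), ae_reflect (coeFn_reflectL2 f)] with t h1 h2
  rw [h1, h2, sub_sub_cancel]

theorem compLp_reflectL2 (L : X →L[ℝ] Y) (f : L2T T X) :
    L.compLp (reflectL2 T X f) = reflectL2 T Y (L.compLp f) := by
  refine Lp.ext ?_
  filter_upwards [L.coeFn_compLp (reflectL2 T X f), coeFn_reflectL2 f,
    coeFn_reflectL2 (L.compLp f), ae_reflect (L.coeFn_compLp f)] with t h1 h2 h3 h4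
  rw [h1, h2, h3, h4]

theorem setIntegral_reflect (F : ℝ → X) :
    ∫ t in Ioo 0 T, F (T - t) = ∫ t in Ioo 0 T, F t :=
  (measurePreserving_reflect T).integral_comp
    (Homeomorph.subLeft T).measurableEmbedding F

end L2

/-! ### Replacing L²(0,T;V') by the Hilbert space L²(0,T;V) -/

section Riesz

variable {V H : Type*} [NormedAddCommGroup V] [InnerProductSpace ℝ V] [CompleteSpace V]
  [NormedAddCommGroup H] [InnerProductSpace ℝ H] [CompleteSpace H] {T : ℝ}

/-- The Riesz isomorphism `V' → V`. -/
def riesz (V : Type*) [NormedAddCommGroup V] [InnerProductSpace ℝ V] [CompleteSpace V] :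
    StrongDual ℝ V →L[ℝ] V :=
  LinearMap.mkContinuous
    { toFun := (InnerProductSpace.toDual ℝ V).symm
      map_add' := fun F G => map_add _ F G
      map_smul' := fun c F => by simp } 1 (fun F => by simp)

theorem inner_riesz (F : StrongDual ℝ V) (v : V) : inner ℝ (riesz V F) v = F v :=
  InnerProductSpace.toDual_symm_apply (𝕜 := ℝ) (x := v) (y := F)

theorem norm_riesz (F : StrongDual ℝ V) : ‖riesz V F‖ = ‖F‖ :=
  (InnerProductSpace.toDual ℝ V).symm.norm_map F

theorem riesz_pivotEmb (ι : V →L[ℝ] H) (h : H) : riesz V (pivotEmb ι h) = ι.adjoint h := by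
  refine ext_inner_right ℝ fun v => ?_
  rw [inner_riesz, pivotEmb_apply, ι.adjoint_inner_left]

/-- The Riesz isomorphism `L²(0,T;V') → L²(0,T;V)`. -/
def rieszL2 (T : ℝ) (V : Type*) [NormedAddCommGroup V] [InnerProductSpace ℝ V] [CompleteSpace V] :
    L2T T (StrongDual ℝ V) →L[ℝ] L2T T V := (riesz V).compLpL 2 (timeMeasure T)

theorem coeFn_rieszL2 (F : L2T T (StrongDual ℝ V)) :
    ∀ᵐ t ∂(timeMeasure T), rieszL2 T V F t = riesz V (F t) := (riesz V).coeFn_compLp F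

theorem norm_rieszL2 (F : L2T T (StrongDual ℝ V)) : ‖rieszL2 T V F‖ = ‖F‖ :=
  norm_compLp_of_isometry _ norm_riesz F

theorem rieszL2_injective : Function.Injective (rieszL2 T V) := by
  rw [injective_iff_map_eq_zero]
  intro F hF
  rw [← norm_eq_zero, ← norm_rieszL2, hF, norm_zero]

/-- Turns the duality pairing into an inner product, so that orthogonality arguments become
available for V'-valued data. -/
theorem inner_rieszL2 (F : L2T T (StrongDual ℝ V)) (v : L2T T V) :
    inner ℝ (rieszL2 T V F) v = ∫ t in Ioo 0 T, F t (v t) := by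
  rw [L2.inner_def]
  refine integral_congr_ae ?_
  filter_upwards [coeFn_rieszL2 F] with t h
  rw [h, inner_riesz]

theorem integrable_dual_apply (F : L2T T (StrongDual ℝ V)) (v : L2T T V) :
    Integrable (fun t => F t (v t)) (timeMeasure T) := by
  refine (L2.integrable_inner (𝕜 := ℝ) (rieszL2 T V F) v).congr ?_
  filter_upwards [coeFn_rieszL2 F] with t h
  rw [h, inner_riesz]

/-- Transposition under the time integral; this is how 𝒜* enters both the surjectivity proof and the
adjoint equation. -/
theorem inner_rieszL2_compLp_flip (L : V →L[ℝ] StrongDual ℝ V) (v w : L2T T V) :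
    inner ℝ (rieszL2 T V (L.compLp v)) w = inner ℝ (rieszL2 T V (L.flip.compLp w)) v := by
  rw [inner_rieszL2, inner_rieszL2]
  refine integral_congr_ae ?_
  filter_upwards [L.coeFn_compLp v, L.flip.coeFn_compLp w] with t h1 h2
  rw [h1, h2, ContinuousLinearMap.flip_apply]

/-- The weak derivative, tested against `φ v` with scalar `φ` and `v ∈ V`. -/
theorem isWeakTimeDeriv_iff (ι : V →L[ℝ] H) {y : L2T T V} {dy : L2T T (StrongDual ℝ V)} :
    IsWeakTimeDeriv ι T y dy ↔ ∀ φ : ℝ → ℝ, ∀ hφ : ContDiff ℝ ∞ φ, HasCompactSupport φ →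
      tsupport φ ⊆ Ioo 0 T → ∀ v : V,
      inner ℝ (smulL2 T (hφ.continuous_deriv (by simp)) (gramOp ι v)) y
        = - inner ℝ (smulL2 T hφ.continuous v) (rieszL2 T V dy) := by
  refine forall_congr' fun φ => forall_congr' fun hφ => forall_congr' fun hc =>
    forall_congr' fun hs => ?_
  rw [ContinuousLinearMap.ext_iff]
  refine forall_congr' fun v => ?_
  have h1 : (∫ t in Ioo 0 T, deriv φ t • pivotEmb ι (ι (y t))) v
      = inner ℝ (smulL2 T (hφ.continuous_deriv (by simp)) (gramOp ι v)) y := by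
    rw [ContinuousLinearMap.integral_apply (integrable_deriv_test_smul ι hφ hc y), inner_smulL2]
    refine integral_congr_ae (Eventually.of_forall fun t => ?_)
    simp only [smul_apply, pivotEmb_apply, smul_eq_mul]
    rw [inner_gramOp_left, real_inner_comm]
  have h2 : (∫ t in Ioo 0 T, φ t • dy t) v
      = inner ℝ (smulL2 T hφ.continuous v) (rieszL2 T V dy) := by
    rw [ContinuousLinearMap.integral_apply (integrable_test_smul hφ.continuous hc dy),
      inner_smulL2]
    refine integral_congr_ae ?_
    filter_upwards [coeFn_rieszL2 dy] with t ht
    rw [ht, real_inner_comm, inner_riesz]; rfl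
  rw [neg_apply, h1, h2]

end Riesz

/-! ### The space W_T: completeness, evaluation, integration by parts, time reversal -/

section WSpace

variable {V H : Type*} [NormedAddCommGroup V] [InnerProductSpace ℝ V] [CompleteSpace V]
  [NormedAddCommGroup H] [InnerProductSpace ℝ H] [CompleteSpace H] {ι : V →L[ℝ] H} {T : ℝ}

omit [CompleteSpace V] [CompleteSpace H] in
theorem WT.norm_sq (w : WT ι T) : ‖w‖ ^ 2 = ‖w.fn‖ ^ 2 + ‖w.dt‖ ^ 2 := by
  exact WithLp.prod_norm_sq_eq_of_L2 (w : WithLp 2 (L2T T V × L2T T (StrongDual ℝ V)))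

omit [CompleteSpace V] [CompleteSpace H] in
theorem WT.fn_add (w z : WT ι T) : (w + z).fn = w.fn + z.fn := rfl

omit [CompleteSpace V] [CompleteSpace H] in
theorem WT.dt_add (w z : WT ι T) : (w + z).dt = w.dt + z.dt := rfl

omit [CompleteSpace V] [CompleteSpace H] in
theorem WT.fn_smul (c : ℝ) (w : WT ι T) : (c • w).fn = c • w.fn := rfl

/-- By `isWeakTimeDeriv_iff` the weak derivative relation is an intersection of equations between
continuous functionals, hence closed. Completeness is what makes the range closed and the bounded
bijections isomorphisms. -/
instance : CompleteSpace (WT ι T) := by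
  have hcl : IsClosed {w : WithLp 2 (L2T T V × L2T T (StrongDual ℝ V)) |
      IsWeakTimeDeriv ι T w.fst w.snd} := by
    simp only [isWeakTimeDeriv_iff, ofPred_forall]
    refine isClosed_iInter fun φ => isClosed_iInter fun hφ => isClosed_iInter fun _ =>
      isClosed_iInter fun _ => isClosed_iInter fun v => ?_
    have h1 : Continuous fun w : WithLp 2 (L2T T V × L2T T (StrongDual ℝ V)) => w.fst :=
      (WithLp.fstL 2 ℝ (L2T T V) (L2T T (StrongDual ℝ V))).continuous
    have h2 : Continuous fun w : WithLp 2 (L2T T V × L2T T (StrongDual ℝ V)) => w.snd :=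
      (WithLp.sndL 2 ℝ (L2T T V) (L2T T (StrongDual ℝ V))).continuous
    exact isClosed_eq (continuous_const.inner h1)
      (continuous_const.inner ((rieszL2 T V).continuous.comp h2)).neg
  exact hcl.completeSpace_coe

/-- The Riesz map sends the pivot embedding to ι*, so the weak derivative equation in V' becomes one
for ι*ι w in V. -/
theorem WT.exists_ae_gramOp_eq_primitive (hT : 0 < T) (w : WT ι T) :
    ∃ x₀ : V, ∀ᵐ t ∂(timeMeasure T),
      gramOp ι (w.fn t) = x₀ + ∫ s in (0 : ℝ)..t, rieszL2 T V w.dt s := by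
  refine exists_ae_eq_add_integral_of_weakDeriv hT
    ((gramOp ι).integrable_comp (integrable_L2T w.fn)) (integrable_L2T _)
    (fun φ hφ hc hs => ?_)
  have h := congrArg (riesz V) (w.2 φ hφ hc hs)
  rw [map_neg, ← (riesz V).integral_comp_comm (integrable_deriv_test_smul ι hφ hc _),
    ← (riesz V).integral_comp_comm (integrable_test_smul hφ.continuous hc _)] at h
  simp only [map_smul, riesz_pivotEmb, ← gramOp_apply] at h
  refine h.trans ?_
  congr 1
  refine integral_congr_ae ?_
  filter_upwards [coeFn_rieszL2 w.dt] with t ht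
  rw [ht]; rfl

theorem WT.exists_isContRep_norm_sq (hι : Function.Injective ι) (hT : 0 < T) (w : WT ι T) :
    ∃ u : ℝ → H, IsContRep w u ∧ ∀ t ∈ Icc 0 T,
      ‖u t‖ ^ 2 = ‖u 0‖ ^ 2 + 2 * ∫ s in (0 : ℝ)..t, w.dt s (w.fn s) := by
  obtain ⟨x₀, hx⟩ := w.exists_ae_gramOp_eq_primitive hT
  obtain ⟨u, h1, h2, -, h3⟩ := exists_continuousOn_rep hι hT (Lp.memLp w.fn)
    (Lp.memLp (rieszL2 T V w.dt)) hx
  refine ⟨u, ⟨h1, h2⟩, fun t ht => ?_⟩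
  rw [h3 t ht]
  congr 2
  refine intervalIntegral.integral_congr_ae ?_
  have := ae_timeMeasure_iff.1 (coeFn_rieszL2 w.dt)
  filter_upwards [this] with s hs hmem
  rw [uIoc_of_le ht.1] at hmem
  rw [hs ⟨hmem.1, hmem.2.trans ht.2⟩, inner_riesz]

omit [CompleteSpace V] [CompleteSpace H] in
theorem IsContRep.eqOn (hT : 0 < T) {w : WT ι T} {u u' : ℝ → H} (hu : IsContRep w u)
    (hu' : IsContRep w u') : EqOn u u' (Icc 0 T) := by
  refine Measure.eqOn_Icc_of_ae_eq volume hT.ne ?_ hu.1 hu'.1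
  rw [← restrict_Ioo_eq_restrict_Icc]
  filter_upwards [hu.2, hu'.2] with t h1 h2
  rw [h1, h2]

omit [CompleteSpace V] [CompleteSpace H] in
theorem evalT_eq (hT : 0 < T) {w : WT ι T} {u : ℝ → H} (hu : IsContRep w u) {t : ℝ}
    (ht : t ∈ Icc 0 T) : evalT t w = u t := by
  have h : ∃ u : ℝ → H, IsContRep w u := ⟨u, hu⟩
  rw [evalT, dif_pos h]
  exact h.choose_spec.eqOn hT hu ht

theorem isContRep_evalT (hι : Function.Injective ι) (hT : 0 < T) (w : WT ι T) :
    IsContRep w (fun t => evalT t w) := by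
  obtain ⟨u, hu, -⟩ := w.exists_isContRep_norm_sq hι hT
  have h : ∃ u : ℝ → H, IsContRep w u := ⟨u, hu⟩
  simp only [evalT, dif_pos h]
  exact h.choose_spec

/-- The energy identity. -/
theorem norm_sq_evalT (hι : Function.Injective ι) (hT : 0 < T) (w : WT ι T) {t : ℝ}
    (ht : t ∈ Icc 0 T) :
    ‖evalT t w‖ ^ 2 = ‖evalT 0 w‖ ^ 2 + 2 * ∫ s in (0 : ℝ)..t, w.dt s (w.fn s) := by
  obtain ⟨u, hu, h⟩ := w.exists_isContRep_norm_sq hι hT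
  rw [evalT_eq hT hu ht, evalT_eq hT hu ⟨le_rfl, hT.le⟩, h t ht]

theorem evalT_add (hι : Function.Injective ι) (hT : 0 < T) (w z : WT ι T) {t : ℝ}
    (ht : t ∈ Icc 0 T) : evalT t (w + z) = evalT t w + evalT t z := by
  have hw := isContRep_evalT hι hT w
  have hz := isContRep_evalT hι hT z
  refine evalT_eq (u := fun t => evalT t w + evalT t z) hT ⟨hw.1.add hz.1, ?_⟩ ht
  filter_upwards [hw.2, hz.2, Lp.coeFn_add w.fn z.fn] with s h1 h2 h3
  rw [h1, h2, WT.fn_add, h3, Pi.add_apply, map_add]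

theorem evalT_smul (hι : Function.Injective ι) (hT : 0 < T) (c : ℝ) (w : WT ι T) {t : ℝ}
    (ht : t ∈ Icc 0 T) : evalT t (c • w) = c • evalT t w := by
  have hw := isContRep_evalT hι hT w
  refine evalT_eq (u := fun t => c • evalT t w) hT ⟨hw.1.const_smul c, ?_⟩ ht
  filter_upwards [hw.2, Lp.coeFn_smul c w.fn] with s h1 h3
  rw [h1, WT.fn_smul, h3, Pi.smul_apply, map_smul]

theorem norm_sq_evalT_T (hι : Function.Injective ι) (hT : 0 < T) (w : WT ι T) :
    ‖evalT T w‖ ^ 2 = ‖evalT 0 w‖ ^ 2 + 2 * inner ℝ (rieszL2 T V w.dt) w.fn := by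
  rw [norm_sq_evalT hι hT w ⟨hT.le, le_rfl⟩, inner_rieszL2,
    integral_timeMeasure_eq_intervalIntegral hT.le]

/-- Integration by parts in `W(0,T;V,V')`. -/
theorem inner_evalT_sub (hι : Function.Injective ι) (hT : 0 < T) (w z : WT ι T) :
    inner ℝ (evalT T w) (evalT T z) - inner ℝ (evalT 0 w) (evalT 0 z)
      = inner ℝ (rieszL2 T V w.dt) z.fn + inner ℝ (rieszL2 T V z.dt) w.fn := by
  -- Polarisation of the energy identity.
  have h := norm_sq_evalT_T hι hT (w + z)
  rw [evalT_add hι hT w z ⟨hT.le, le_rfl⟩, evalT_add hι hT w z ⟨le_rfl, hT.le⟩, WT.fn_add,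
    WT.dt_add, map_add, inner_add_left, inner_add_right, inner_add_right, norm_add_sq_real,
    norm_add_sq_real, norm_sq_evalT_T hι hT w, norm_sq_evalT_T hι hT z] at h
  linarith

/-- Comparing the energy identity at t and at s gives ‖w(t)‖² ≤ ‖w(s)‖² + 4D with D = ∫|⟨w', w⟩|;
averaging over s in (0,T) yields the bound. It degenerates as T → 0, but serves only for continuity
of evaluation at fixed T; the final constants come from the energy estimates. -/
theorem norm_sq_evalT_le (hι : Function.Injective ι) (hT : 0 < T) (w : WT ι T) {t : ℝ}
    (ht : t ∈ Icc 0 T) : ‖evalT t w‖ ^ 2 ≤ (‖ι‖ ^ 2 / T + 4) * ‖w‖ ^ 2 := by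
  have hw := WT.norm_sq w
  set D := ∫ s in Ioo 0 T, ‖w.dt s (w.fn s)‖ with hD
  have hDle : D ≤ ‖w.dt‖ * ‖w.fn‖ := by
    have h1 : D ≤ ∫ s in Ioo 0 T, ‖rieszL2 T V w.dt s‖ * ‖w.fn s‖ := by
      refine integral_mono_ae (integrable_dual_apply _ _).norm
        (integrable_norm_mul_norm (Lp.memLp _) (Lp.memLp _)) ?_
      filter_upwards [coeFn_rieszL2 w.dt] with s hs
      rw [hs, norm_riesz]
      exact (w.dt s).le_opNorm _
    have h2 : ∫ s in Ioo 0 T, ‖rieszL2 T V w.dt s‖ * ‖w.fn s‖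
        ≤ ‖rieszL2 T V w.dt‖ * ‖w.fn‖ := by
      have h3 := integral_mul_norm_le_Lp_mul_Lq (μ := timeMeasure T)
        (f := fun s => rieszL2 T V w.dt s) (g := fun s => w.fn s) Real.HolderConjugate.two_two
        (by simpa using Lp.memLp (rieszL2 T V w.dt)) (by simpa using Lp.memLp w.fn)
      simp only [Real.rpow_two] at h3
      rw [← norm_sq_L2T_eq_integral, ← norm_sq_L2T_eq_integral, ← Real.sqrt_eq_rpow,
        ← Real.sqrt_eq_rpow, Real.sqrt_sq (norm_nonneg _), Real.sqrt_sq (norm_nonneg _)] at h3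
      exact h3
    rw [norm_rieszL2] at h2
    exact h1.trans h2
  have hint : ∀ {r : ℝ}, r ∈ Icc 0 T → |∫ s in (0 : ℝ)..r, w.dt s (w.fn s)| ≤ D := by
    intro r hr
    rw [← Real.norm_eq_abs, intervalIntegral.integral_of_le hr.1]
    refine (norm_integral_le_integral_norm _).trans ?_
    rw [hD, ← integral_Ioc_eq_integral_Ioo]
    refine setIntegral_mono_set ?_ (Eventually.of_forall fun s => norm_nonneg _)
      (Ioc_subset_Ioc_right hr.2).eventuallyLE
    exact integrableOn_Ioc_iff_timeMeasure.2 (integrable_dual_apply w.dt w.fn).norm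
  have hpt : ∀ᵐ s ∂(timeMeasure T), ‖evalT t w‖ ^ 2 ≤ ‖ι‖ ^ 2 * ‖w.fn s‖ ^ 2 + 4 * D := by
    filter_upwards [(isContRep_evalT hι hT w).2, ae_restrict_mem measurableSet_Ioo] with s hs hmem
    have h1 := norm_sq_evalT hι hT w ht
    have h2 := norm_sq_evalT hι hT w (Ioo_subset_Icc_self hmem)
    have h3 := (abs_le.1 (hint ht)).2
    have h4 := (abs_le.1 (hint (Ioo_subset_Icc_self hmem))).1
    have h5 : ‖evalT s w‖ ^ 2 ≤ ‖ι‖ ^ 2 * ‖w.fn s‖ ^ 2 := by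
      rw [hs, ← mul_pow]
      exact pow_le_pow_left₀ (norm_nonneg _) (ι.le_opNorm _) 2
    linarith
  have hI : ∫ s in Ioo 0 T, ‖evalT t w‖ ^ 2
      ≤ ∫ s in Ioo 0 T, (‖ι‖ ^ 2 * ‖w.fn s‖ ^ 2 + 4 * D) := integral_mono_ae (integrable_const _)
    (((integrable_norm_sq_L2T w.fn).const_mul (‖ι‖ ^ 2)).add (integrable_const (4 * D))) hpt
  rw [integral_add ((integrable_norm_sq_L2T w.fn).const_mul (‖ι‖ ^ 2)) (integrable_const _),
    integral_const_mul, ← norm_sq_L2T_eq_integral] at hI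
  simp only [integral_const, smul_eq_mul] at hI
  have hvol : (timeMeasure T).real univ = T := by
    simp [Measure.real, hT.le]
  rw [hvol] at hI
  rw [div_add' _ _ _ hT.ne', div_mul_eq_mul_div, le_div_iff₀ hT, hw]
  nlinarith [sq_nonneg (‖w.dt‖ - ‖w.fn‖), sq_nonneg ‖w.dt‖, sq_nonneg ‖w.fn‖, sq_nonneg ‖ι‖,
    mul_nonneg (sq_nonneg ‖ι‖) (sq_nonneg ‖w.dt‖), mul_le_mul_of_nonneg_left hDle hT.le,
    mul_nonneg hT.le (sq_nonneg (‖w.dt‖ - ‖w.fn‖)), mul_nonneg hT.le (sq_nonneg ‖w.dt‖),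
    mul_nonneg hT.le (sq_nonneg ‖w.fn‖)]

/-- The evaluation `E_t : W_T → H` as a bounded operator. -/
def evalCLM (hι : Function.Injective ι) (hT : 0 < T) {t : ℝ} (ht : t ∈ Icc 0 T) :
    WT ι T →L[ℝ] H :=
  LinearMap.mkContinuous
    { toFun := evalT t
      map_add' := fun w z => evalT_add hι hT w z ht
      map_smul' := fun c w => evalT_smul hι hT c w ht } (√(‖ι‖ ^ 2 / T + 4)) (fun w => by
    refine le_of_sq_le_sq ?_ (by positivity)
    rw [mul_pow, Real.sq_sqrt (by positivity)]
    exact norm_sq_evalT_le hι hT w ht)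

/-- The underlying function, as a bounded operator. -/
def WT.fnL (ι : V →L[ℝ] H) (T : ℝ) : WT ι T →L[ℝ] L2T T V :=
  (WithLp.fstL 2 ℝ (L2T T V) (L2T T (StrongDual ℝ V))).comp (WSubmodule ι T).subtypeL

/-- The weak derivative, as a bounded operator. -/
def WT.dtL (ι : V →L[ℝ] H) (T : ℝ) : WT ι T →L[ℝ] L2T T (StrongDual ℝ V) :=
  (WithLp.sndL 2 ℝ (L2T T V) (L2T T (StrongDual ℝ V))).comp (WSubmodule ι T).subtypeL

/-- Time reversal `w ↦ w(T - ·)` on `W_T`. -/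
def WT.reflect (w : WT ι T) : WT ι T :=
  ⟨WithLp.toLp 2 (reflectL2 T V w.fn, -reflectL2 T (StrongDual ℝ V) w.dt), by
    intro φ hφ hc hs
    have hφ' : ContDiff ℝ ∞ (fun t => φ (T - t)) := hφ.comp (contDiff_const.sub contDiff_id)
    have hc' : HasCompactSupport (fun t => φ (T - t)) :=
      hc.comp_homeomorph (Homeomorph.subLeft T)
    have hs' : tsupport (fun t => φ (T - t)) ⊆ Ioo 0 T := by
      have := tsupport_comp_eq_preimage φ (Homeomorph.subLeft T)
      intro t ht
      have h1 : t ∈ Homeomorph.subLeft T ⁻¹' tsupport φ := this ▸ ht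
      have h2 : T - t ∈ Ioo 0 T := hs h1
      constructor <;> linarith [h2.1, h2.2]
    have key := w.2 _ hφ' hc' hs'
    -- The weak equation for w is tested with the reflected φ and both integrals are reflected back;
    -- the chain rule supplies the minus sign in the derivative.
    rw [← setIntegral_reflect, ← setIntegral_reflect (T := T)
      (F := fun t => (fun t => φ (T - t)) t • _)] at key
    have h1 : ∫ t in Ioo 0 T, deriv φ t • pivotEmb ι (ι (reflectL2 T V w.fn t))
        = - ∫ t in Ioo 0 T, deriv (fun t => φ (T - t)) (T - t) •
          pivotEmb ι (ι (w.fn (T - t))) := by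
      rw [← integral_neg]
      refine integral_congr_ae ?_
      filter_upwards [coeFn_reflectL2 w.fn] with t ht
      have hd : deriv (fun t => φ (T - t)) (T - t) = - deriv φ t := by
        rw [deriv_comp_const_sub, sub_sub_cancel]
      rw [ht, hd]
      exact (neg_eq_iff_eq_neg.2
        (neg_smul (deriv φ t) (pivotEmb ι (ι (w.fn (T - t)))))).symm
    have h2 : ∫ t in Ioo 0 T, φ t • (-reflectL2 T (StrongDual ℝ V) w.dt : L2T T _) t
        = - ∫ t in Ioo 0 T, φ (T - (T - t)) • w.dt (T - t) := by
      rw [← integral_neg]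
      refine integral_congr_ae ?_
      filter_upwards [coeFn_reflectL2 w.dt,
        Lp.coeFn_neg (reflectL2 T (StrongDual ℝ V) w.dt)] with t ht ht'
      rw [ht', Pi.neg_apply, ht, sub_sub_cancel, smul_neg]
    refine h1.trans ?_
    refine Eq.trans ?_ (congrArg Neg.neg h2).symm
    exact congrArg Neg.neg key⟩

omit [CompleteSpace V] [CompleteSpace H] in
theorem WT.fn_reflect (w : WT ι T) : w.reflect.fn = reflectL2 T V w.fn := rfl

omit [CompleteSpace V] [CompleteSpace H] in
theorem WT.dt_reflect (w : WT ι T) : w.reflect.dt = -reflectL2 T (StrongDual ℝ V) w.dt := rfl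

omit [CompleteSpace V] [CompleteSpace H] in
theorem WT.norm_reflect (w : WT ι T) : ‖w.reflect‖ = ‖w‖ := by
  rw [← sq_eq_sq₀ (norm_nonneg _) (norm_nonneg _), WT.norm_sq, WT.norm_sq, WT.fn_reflect,
    WT.dt_reflect, norm_neg, LinearIsometry.norm_map, LinearIsometry.norm_map]

theorem evalT_reflect (hι : Function.Injective ι) (hT : 0 < T) (w : WT ι T) {t : ℝ}
    (ht : t ∈ Icc 0 T) : evalT t w.reflect = evalT (T - t) w := by
  have hw := isContRep_evalT hι hT w
  refine evalT_eq (u := fun t => evalT (T - t) w) hT ⟨?_, ?_⟩ ht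
  · refine hw.1.comp (by fun_prop) fun s hs => ?_
    exact ⟨by linarith [hs.2], by linarith [hs.1]⟩
  · filter_upwards [ae_reflect hw.2, coeFn_reflectL2 w.fn] with s h1 h2
    rw [h1, WT.fn_reflect, h2]

/-- The element `ψ v` of `W_T` for `ψ` continuously differentiable and `v ∈ V`. -/
def WT.smulConst (ι : V →L[ℝ] H) (T : ℝ) (hT : 0 < T) {ψ : ℝ → ℝ} (hψ : ContDiff ℝ 1 ψ) (v : V) :
    WT ι T :=
  ⟨WithLp.toLp 2 (smulL2 T hψ.continuous v,
    smulL2 T (hψ.continuous_deriv le_rfl) (pivotEmb ι (ι v))), by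
    have hψd := hψ.continuous_deriv le_rfl
    intro φ hφ hc hs
    have hφd : Continuous (deriv φ) := hφ.continuous_deriv (by simp)
    have hφz : ∀ x ∉ Ioo 0 T, φ x = 0 :=
      fun x hx => image_eq_zero_of_notMem_tsupport fun h => hx (hs h)
    have h1 : ∫ t in Ioo 0 T, deriv φ t • pivotEmb ι (ι (smulL2 T hψ.continuous v t))
        = (∫ t in Ioo 0 T, deriv φ t * ψ t) • pivotEmb ι (ι v) := by
      exact integral_smul_smulL2 (pivotEmb ι ∘L ι) (deriv φ) hψ.continuous v
    have h2 : ∫ t in Ioo 0 T, φ t • smulL2 T hψd (pivotEmb ι (ι v)) t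
        = (∫ t in Ioo 0 T, φ t * deriv ψ t) • pivotEmb ι (ι v) := by
      exact integral_smul_smulL2 (ContinuousLinearMap.id ℝ (StrongDual ℝ V)) φ hψd _
    refine h1.trans (Eq.trans ?_ (congrArg Neg.neg h2).symm)
    refine Eq.trans ?_ (neg_smul (∫ t in Ioo 0 T, φ t * deriv ψ t) (pivotEmb ι (ι v)))
    congr 1
    rw [integral_timeMeasure_eq_intervalIntegral hT.le,
      integral_timeMeasure_eq_intervalIntegral hT.le]
    have := intervalIntegral.integral_mul_deriv_eq_deriv_mul (a := 0) (b := T) (u := φ) (v := ψ)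
      (u' := deriv φ) (v' := deriv ψ)
      (fun x _ => (hφ.differentiable (by simp) x).hasDerivAt)
      (fun x _ => (hψ.differentiable one_ne_zero x).hasDerivAt)
      (hφd.intervalIntegrable _ _) (hψd.intervalIntegrable _ _)
    rw [hφz 0 (by simp), hφz T (by simp)] at this
    linarith⟩

omit [CompleteSpace V] [CompleteSpace H] in
theorem WT.fn_smulConst (hT : 0 < T) {ψ : ℝ → ℝ} (hψ : ContDiff ℝ 1 ψ) (v : V) :
    (WT.smulConst ι T hT hψ v).fn = smulL2 T hψ.continuous v := rfl

omit [CompleteSpace V] [CompleteSpace H] in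
theorem WT.dt_smulConst (hT : 0 < T) {ψ : ℝ → ℝ} (hψ : ContDiff ℝ 1 ψ) (v : V) :
    (WT.smulConst ι T hT hψ v).dt = smulL2 T (hψ.continuous_deriv le_rfl) (pivotEmb ι (ι v)) := rfl

omit [CompleteSpace V] [CompleteSpace H] in
theorem evalT_smulConst (hT : 0 < T) {ψ : ℝ → ℝ} (hψ : ContDiff ℝ 1 ψ) (v : V) {t : ℝ}
    (ht : t ∈ Icc 0 T) : evalT t (WT.smulConst ι T hT hψ v) = ψ t • ι v := by
  refine evalT_eq (u := fun t => ψ t • ι v) hT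
    ⟨(hψ.continuous.smul continuous_const).continuousOn, ?_⟩ ht
  filter_upwards [coeFn_smulL2 hψ.continuous v] with s hs
  rw [WT.fn_smulConst, hs, map_smul]

end WSpace

/-! ### Gronwall, an isomorphism criterion and elementary facts on the constants -/

/-- Gronwall's inequality in integral form. -/
theorem le_mul_exp_of_le_add_integral {m : ℝ → ℝ} {T K c : ℝ} (hm : ContinuousOn m (Icc 0 T))
    (hc : 0 ≤ c) (h : ∀ t ∈ Icc 0 T, m t ≤ K + c * ∫ s in (0 : ℝ)..t, m s) {t : ℝ}
    (ht : t ∈ Icc 0 T) : m t ≤ K * Real.exp (c * t) := by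
  have hT : 0 ≤ T := ht.1.trans ht.2
  have hmi : ∀ {s : ℝ}, s ∈ Icc 0 T → IntervalIntegrable m volume 0 s := fun hs =>
    (hm.mono (Icc_subset_Icc_right hs.2)).intervalIntegrable_of_Icc hs.1
  have hcont : ContinuousOn (fun t => K + c * ∫ s in (0 : ℝ)..t, m s) (Icc 0 T) := by
    have := intervalIntegral.continuousOn_primitive_interval' (hmi ⟨hT, le_rfl⟩) left_mem_uIcc
    rw [uIcc_of_le hT] at this
    exact continuousOn_const.add (continuousOn_const.mul this)
  -- Differential Gronwall is applied to F(t) = K + c∫m rather than to m: F is right differentiable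
  -- with F' = c m ≤ c F.
  have key := le_gronwallBound_of_liminf_deriv_right_le
    (f := fun t => K + c * ∫ s in (0 : ℝ)..t, m s) (f' := fun t => c * m t) (δ := K) (K := c) (ε := 0) (a := 0) (b := T) hcont
    (fun x hx r hr => ?_) (by simp) (fun x hx => ?_) t ht
  · rw [gronwallBound_ε0, sub_zero] at key
    exact (h t ht).trans key
  · have hx' : x ∈ Icc 0 T := Ico_subset_Icc_self hx
    have hmx : ContinuousWithinAt m (Ioi x) x :=
      (hm x hx').mono_of_mem_nhdsWithin
        (mem_of_superset (Ioc_mem_nhdsGT hx.2) fun z hz => ⟨hx.1.trans hz.1.le, hz.2⟩)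
    have hmeas : StronglyMeasurableAtFilter m (𝓝[>] x) volume :=
      ⟨Ioc x T, Ioc_mem_nhdsGT hx.2,
        (hm.mono fun z hz => ⟨hx.1.trans hz.1.le, hz.2⟩).aestronglyMeasurable measurableSet_Ioc⟩
    have hd := intervalIntegral.integral_hasDerivWithinAt_right (hmi hx') (s := Ici x)
      (t := Ioi x) hmeas hmx
    have hd' : HasDerivWithinAt (fun t => K + c * ∫ s in (0 : ℝ)..t, m s) (c * m x) (Ici x) x :=
      (hd.const_mul c).const_add K
    have := hd'.liminf_right_slope_le hr
    refine this.mono fun z hz => ?_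
    rwa [slope_def_field, div_eq_inv_mul] at hz
  · rw [add_zero]
    exact mul_le_mul_of_nonneg_left (h x (Ico_subset_Icc_self hx)) hc

/-- A surjective bounded operator that is bounded below is an isomorphism. -/
theorem exists_equiv_of_bound {X Y : Type*} [NormedAddCommGroup X] [NormedSpace ℝ X]
    [CompleteSpace X] [NormedAddCommGroup Y] [NormedSpace ℝ Y] [CompleteSpace Y] (f : X →L[ℝ] Y)
    (g : X → Y) (hfg : ∀ x, f x = g x) {c : ℝ} (hc : 0 ≤ c) (h : ∀ x, ‖x‖ ≤ c * ‖g x‖)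
    (hg : Function.Surjective g) :
    ∃ e : X ≃L[ℝ] Y, (∀ x, e x = g x) ∧ ‖(e.symm : Y →L[ℝ] X)‖ ≤ c := by
  obtain rfl : ⇑f = g := funext hfg
  have hinj : LinearMap.ker (f : X →ₗ[ℝ] Y) = ⊥ := by
    rw [LinearMap.ker_eq_bot']
    intro x hx
    have h1 : f x = 0 := hx
    have h2 := h x
    rw [h1, norm_zero, mul_zero] at h2
    exact norm_le_zero_iff.1 h2
  let e := ContinuousLinearEquiv.ofBijective f hinj (LinearMap.range_eq_top.2 hg)
  refine ⟨e, fun x => rfl, ContinuousLinearMap.opNorm_le_bound _ hc fun y => ?_⟩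
  have h1 := h (e.symm y)
  have h2 : f (e.symm y) = y := e.apply_symm_apply y
  rwa [h2] at h1

theorem kappaConst_nonneg {θ ρ T : ℝ} (hT : 0 ≤ T) : 0 ≤ kappaConst θ ρ T := by
  unfold kappaConst
  have h1 : 0 ≤ max ρ 0 := le_max_right _ _
  have h2 : 0 ≤ max 1 (1 / (2 * θ)) := zero_le_one.trans (le_max_left _ _)
  positivity

theorem sq_cA {θ ρ CA T : ℝ} (hθ : 0 < θ) (hT : 0 ≤ T) : cA θ ρ CA T ^ 2
    = (1 + 2 * CA ^ 2) * ((1 + kappaConst θ ρ T) / θ) + (1 + 2 * CA ^ 2) * (kappaConst θ ρ T / θ)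
      + (1 + 2 * CA ^ 2) / θ ^ 2 + 2 := by
  have := kappaConst_nonneg (θ := θ) (ρ := ρ) hT
  exact Real.sq_sqrt (by positivity)

/-! ### The parabolic problem: a priori estimate and surjectivity -/

section Parabolic

variable {V H : Type*} [NormedAddCommGroup V] [InnerProductSpace ℝ V] [CompleteSpace V]
  [NormedAddCommGroup H] [InnerProductSpace ℝ H] [CompleteSpace H] {ι : V →L[ℝ] H} {T : ℝ}
  {𝒜 : V →L[ℝ] StrongDual ℝ V} {θ ρ CA : ℝ}

theorem norm_sq_L2T_dual (F : L2T T (StrongDual ℝ V)) : ‖F‖ ^ 2 = ∫ t in Ioo 0 T, ‖F t‖ ^ 2 := by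
  rw [← norm_rieszL2, norm_sq_L2T_eq_integral]
  refine integral_congr_ae ?_
  filter_upwards [coeFn_rieszL2 F] with t ht
  rw [ht, norm_riesz]

/-- The Gårding inequality for `-𝒜`. -/
def IsGarding (ι : V →L[ℝ] H) (𝒜 : V →L[ℝ] StrongDual ℝ V) (θ ρ : ℝ) : Prop :=
  ∀ v, 𝒜 v v ≤ ρ * ‖ι v‖ ^ 2 - θ * ‖v‖ ^ 2

omit [CompleteSpace V] [CompleteSpace H] in
theorem IsGarding.flip (h : IsGarding ι 𝒜 θ ρ) : IsGarding ι 𝒜.flip θ ρ := fun v => h v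

/-- The residual `w' - 𝒜 w`. -/
def evolResidual (𝒜 : V →L[ℝ] StrongDual ℝ V) (w : WT ι T) : L2T T (StrongDual ℝ V) :=
  w.dt - 𝒜.compLp w.fn

omit [CompleteSpace V] [CompleteSpace H] in
theorem coeFn_evolResidual (𝒜 : V →L[ℝ] StrongDual ℝ V) (w : WT ι T) :
    ∀ᵐ t ∂(timeMeasure T), w.dt t = evolResidual 𝒜 w t + 𝒜 (w.fn t) := by
  filter_upwards [Lp.coeFn_sub w.dt (𝒜.compLp w.fn), 𝒜.coeFn_compLp w.fn] with t h1 h2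
  rw [evolResidual, h1, Pi.sub_apply, h2, sub_add_cancel]

/-- Energy identity, Gårding and the weighted Young inequality 2ab ≤ l a² + l⁻¹ b². The dissipation
2θ is split into l⁻¹, which absorbs the source, and μ, which survives: (l, μ) = (1/(2θ), 0) serves
the pointwise bound and (1/θ, θ) the bound in L²(0,T;V). -/
theorem norm_sq_evalT_add_le (hι : Function.Injective ι) (hT : 0 < T) (hA : IsGarding ι 𝒜 θ ρ)
    {l μ : ℝ} (hl : 0 < l) (hμ : μ + l⁻¹ = 2 * θ) (w : WT ι T) {t : ℝ} (ht : t ∈ Icc 0 T) :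
    ‖evalT t w‖ ^ 2 + μ * ∫ s in (0 : ℝ)..t, ‖w.fn s‖ ^ 2
      ≤ ‖evalT 0 w‖ ^ 2 + (l * ∫ s in (0 : ℝ)..t, ‖evolResidual 𝒜 w s‖ ^ 2)
        + 2 * max ρ 0 * ∫ s in (0 : ℝ)..t, ‖evalT s w‖ ^ 2 := by
  have hw := isContRep_evalT hι hT w
  have hres : ∀ {F : ℝ → ℝ}, Integrable F (timeMeasure T) → IntervalIntegrable F volume 0 t :=
    fun hF => (intervalIntegrable_of_integrable_timeMeasure hT.le hF).mono_set (by
      rw [uIcc_of_le ht.1, uIcc_of_le hT.le]; exact Icc_subset_Icc_right ht.2)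
  have i1 := hres (integrable_dual_apply w.dt w.fn)
  have i2 := hres (integrable_norm_sq_L2T w.fn)
  have i3 := hres (integrable_norm_sq_L2T (evolResidual 𝒜 w))
  have i4 : IntervalIntegrable (fun s => ‖evalT s w‖ ^ 2) volume 0 t :=
    ((hw.1.mono (Icc_subset_Icc_right ht.2)).norm.pow 2).intervalIntegrable_of_Icc ht.1
  have key : ∫ s in (0 : ℝ)..t, 2 * w.dt s (w.fn s)
      ≤ ∫ s in (0 : ℝ)..t, (l * ‖evolResidual 𝒜 w s‖ ^ 2 + 2 * max ρ 0 * ‖evalT s w‖ ^ 2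
        - μ * ‖w.fn s‖ ^ 2) := by
    have i5 := (i1.const_mul 2).1
    have i6 := (((i3.const_mul l).add (i4.const_mul (2 * max ρ 0))).sub (i2.const_mul μ)).1
    rw [intervalIntegral.integral_of_le ht.1, intervalIntegral.integral_of_le ht.1]
    refine setIntegral_mono_ae_restrict i5 i6 ?_
    rw [EventuallyLE, ae_restrict_iff' measurableSet_Ioc]
    filter_upwards [ae_timeMeasure_iff.1 (coeFn_evolResidual 𝒜 w), ae_timeMeasure_iff.1 hw.2]
      with s h1 h2 hmem
    have hmem' : s ∈ Ioc 0 T := ⟨hmem.1, hmem.2.trans ht.2⟩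
    rw [h1 hmem', h2 hmem', add_apply]
    have h3 : evolResidual 𝒜 w s (w.fn s) ≤ ‖evolResidual 𝒜 w s‖ * ‖w.fn s‖ :=
      (le_abs_self _).trans ((evolResidual 𝒜 w s).le_opNorm _)
    have h4 := hA (w.fn s)
    have h5 : ρ * ‖ι (w.fn s)‖ ^ 2 ≤ max ρ 0 * ‖ι (w.fn s)‖ ^ 2 :=
      mul_le_mul_of_nonneg_right (le_max_left _ _) (sq_nonneg _)
    have h6 : 2 * (‖evolResidual 𝒜 w s‖ * ‖w.fn s‖)
        ≤ l * ‖evolResidual 𝒜 w s‖ ^ 2 + l⁻¹ * ‖w.fn s‖ ^ 2 := by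
      have h7 : 0 ≤ l⁻¹ * (l * ‖evolResidual 𝒜 w s‖ - ‖w.fn s‖) ^ 2 := by positivity
      have h8 : l⁻¹ * (l * ‖evolResidual 𝒜 w s‖ - ‖w.fn s‖) ^ 2
          = l * ‖evolResidual 𝒜 w s‖ ^ 2 + l⁻¹ * ‖w.fn s‖ ^ 2
            - 2 * (‖evolResidual 𝒜 w s‖ * ‖w.fn s‖) := by
        field_simp; ring
      linarith
    have h9 : l⁻¹ = 2 * θ - μ := by linarith
    rw [h9] at h6
    linarith
  rw [intervalIntegral.integral_const_mul, intervalIntegral.integral_sub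
    ((i3.const_mul _).add (i4.const_mul _)) (i2.const_mul _), intervalIntegral.integral_add
    (i3.const_mul _) (i4.const_mul _), intervalIntegral.integral_const_mul,
    intervalIntegral.integral_const_mul, intervalIntegral.integral_const_mul] at key
  rw [norm_sq_evalT hι hT w ht]
  linarith

omit [CompleteSpace H] in
theorem integral_norm_sq_evolResidual_le {t : ℝ} (ht : t ∈ Icc 0 T) (w : WT ι T) :
    ∫ s in (0 : ℝ)..t, ‖evolResidual 𝒜 w s‖ ^ 2 ≤ ‖evolResidual 𝒜 w‖ ^ 2 := by
  rw [norm_sq_L2T_dual, integral_timeMeasure_eq_intervalIntegral (ht.1.trans ht.2)]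
  exact intervalIntegral.integral_mono_interval le_rfl ht.1 ht.2
    (Eventually.of_forall fun s => sq_nonneg _)
    (intervalIntegrable_of_integrable_timeMeasure (ht.1.trans ht.2) (integrable_norm_sq_L2T _))

/-- The origin of κ(T): Gronwall bounds ‖w(s)‖² by K exp(2ρ₊T), integration in time contributes a
factor T, and max{1, 1/(2θ)} merges the two coefficients in K. -/
theorem integral_norm_sq_evalT_le (hι : Function.Injective ι) (hT : 0 < T)
    (hA : IsGarding ι 𝒜 θ ρ) (hθ : 0 < θ) (w : WT ι T) {t : ℝ} (ht : t ∈ Icc 0 T) :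
    2 * max ρ 0 * ∫ s in (0 : ℝ)..t, ‖evalT s w‖ ^ 2
      ≤ kappaConst θ ρ T * (‖evalT 0 w‖ ^ 2 + ‖evolResidual 𝒜 w‖ ^ 2) := by
  have hw := isContRep_evalT hι hT w
  have hm : ContinuousOn (fun t => ‖evalT t w‖ ^ 2) (Icc 0 T) := hw.1.norm.pow 2
  have hρ : 0 ≤ max ρ 0 := le_max_right _ _
  set K := ‖evalT 0 w‖ ^ 2 + (2 * θ)⁻¹ * ‖evolResidual 𝒜 w‖ ^ 2 with hK
  have hKle : K ≤ max 1 (1 / (2 * θ)) * (‖evalT 0 w‖ ^ 2 + ‖evolResidual 𝒜 w‖ ^ 2) := by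
    rw [hK, mul_add, ← one_div]
    refine add_le_add (le_mul_of_one_le_left (sq_nonneg _) (le_max_left _ _)) ?_
    exact mul_le_mul_of_nonneg_right (le_max_right _ _) (sq_nonneg _)
  have hK0 : 0 ≤ K := by positivity
  have hbound : ∀ s ∈ Icc 0 T, ‖evalT s w‖ ^ 2 ≤ K * Real.exp (2 * max ρ 0 * T) := by
    intro s hs
    refine (le_mul_exp_of_le_add_integral hm (c := 2 * max ρ 0) (K := K) (by positivity)
      (fun r hr => ?_) hs).trans ?_
    · have h1 := norm_sq_evalT_add_le hι hT hA (l := (2 * θ)⁻¹) (μ := 0) (by positivity)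
        (by rw [inv_inv, zero_add]) w hr
      have h2 := mul_le_mul_of_nonneg_left (integral_norm_sq_evolResidual_le (𝒜 := 𝒜) hr w)
        (show 0 ≤ (2 * θ)⁻¹ by positivity)
      rw [zero_mul, add_zero] at h1
      linarith
    · gcongr
      exact hs.2
  have h1 : ∫ s in (0 : ℝ)..t, ‖evalT s w‖ ^ 2 ≤ ∫ s in (0 : ℝ)..t,
      K * Real.exp (2 * max ρ 0 * T) :=
    intervalIntegral.integral_mono_on ht.1
      ((hm.mono (Icc_subset_Icc_right ht.2)).intervalIntegrable_of_Icc ht.1)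
      intervalIntegrable_const fun s hs => hbound s ⟨hs.1, hs.2.trans ht.2⟩
  rw [intervalIntegral.integral_const, sub_zero, smul_eq_mul] at h1
  calc _ ≤ 2 * max ρ 0 * (t * (K * Real.exp (2 * max ρ 0 * T))) := by gcongr
    _ ≤ 2 * max ρ 0 * (T * ((max 1 (1 / (2 * θ)) * (‖evalT 0 w‖ ^ 2 + ‖evolResidual 𝒜 w‖ ^ 2))
        * Real.exp (2 * max ρ 0 * T))) := by
        gcongr
        exact ht.2
    _ = _ := by unfold kappaConst; ring

theorem norm_sq_evalT_le_data (hι : Function.Injective ι) (hT : 0 < T)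
    (hA : IsGarding ι 𝒜 θ ρ) (hθ : 0 < θ) (w : WT ι T) {t : ℝ} (ht : t ∈ Icc 0 T) :
    ‖evalT t w‖ ^ 2 ≤ ‖evalT 0 w‖ ^ 2 + θ⁻¹ * ‖evolResidual 𝒜 w‖ ^ 2
      + kappaConst θ ρ T * (‖evalT 0 w‖ ^ 2 + ‖evolResidual 𝒜 w‖ ^ 2) := by
  have h1 := norm_sq_evalT_add_le hι hT hA (l := (2 * θ)⁻¹) (μ := 0) (by positivity)
    (by rw [inv_inv, zero_add]) w ht
  have h2 := mul_le_mul_of_nonneg_left (integral_norm_sq_evolResidual_le (𝒜 := 𝒜) ht w)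
    (show 0 ≤ (2 * θ)⁻¹ by positivity)
  have h3 := integral_norm_sq_evalT_le hι hT hA hθ w ht
  have h4 : (2 * θ)⁻¹ * ‖evolResidual 𝒜 w‖ ^ 2 ≤ θ⁻¹ * ‖evolResidual 𝒜 w‖ ^ 2 := by
    gcongr
    linarith
  rw [zero_mul, add_zero] at h1
  linarith

theorem norm_sq_fn_le_data (hι : Function.Injective ι) (hT : 0 < T)
    (hA : IsGarding ι 𝒜 θ ρ) (hθ : 0 < θ) (w : WT ι T) :
    θ * ‖w.fn‖ ^ 2 ≤ ‖evalT 0 w‖ ^ 2 + θ⁻¹ * ‖evolResidual 𝒜 w‖ ^ 2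
      + kappaConst θ ρ T * (‖evalT 0 w‖ ^ 2 + ‖evolResidual 𝒜 w‖ ^ 2) := by
  have ht : T ∈ Icc 0 T := ⟨hT.le, le_rfl⟩
  have h1 := norm_sq_evalT_add_le hι hT hA (l := θ⁻¹) (μ := θ) (by positivity)
    (by rw [inv_inv]; ring) w ht
  have h2 := mul_le_mul_of_nonneg_left (integral_norm_sq_evolResidual_le (𝒜 := 𝒜) ht w)
    (show 0 ≤ θ⁻¹ by positivity)
  have h3 := integral_norm_sq_evalT_le hι hT hA hθ w ht
  rw [norm_sq_L2T_eq_integral, integral_timeMeasure_eq_intervalIntegral hT.le]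
  linarith [sq_nonneg ‖evalT T w‖]

theorem norm_compLp_le_mul {X Y : Type*} [NormedAddCommGroup X] [NormedSpace ℝ X]
    [NormedAddCommGroup Y] [NormedSpace ℝ Y] (L : X →L[ℝ] Y) (f : L2T T X) :
    ‖L.compLp f‖ ≤ ‖L‖ * ‖f‖ := L.norm_compLp_le f

/-- The a priori estimate for the parabolic problem. -/
theorem norm_sq_le_cA (hι : Function.Injective ι) (hT : 0 < T)
    (hA : IsGarding ι 𝒜 θ ρ) (hθ : 0 < θ) (hCA : ‖𝒜‖ ≤ CA) (w : WT ι T) :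
    ‖w‖ ^ 2 ≤ cA θ ρ CA T ^ 2 * (‖evolResidual 𝒜 w‖ ^ 2 + ‖evalT 0 w‖ ^ 2) := by
  have h1 := norm_sq_fn_le_data hι hT hA hθ w
  have hκ := kappaConst_nonneg (θ := θ) (ρ := ρ) hT.le
  -- The derivative is read off the equation as residual plus 𝒜w. The factor 2 of the squared sum
  -- gives the weight 1 + 2C_A² on ‖w‖² in L²(0,T;V) and the final summand 2 of c_A².
  have h2 : ‖w.dt‖ ^ 2 ≤ 2 * ‖evolResidual 𝒜 w‖ ^ 2 + 2 * CA ^ 2 * ‖w.fn‖ ^ 2 := by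
    have e : w.dt = evolResidual 𝒜 w + 𝒜.compLp w.fn := by rw [evolResidual, sub_add_cancel]
    have h3 : ‖w.dt‖ ≤ ‖evolResidual 𝒜 w‖ + CA * ‖w.fn‖ := by
      calc ‖w.dt‖ = ‖evolResidual 𝒜 w + 𝒜.compLp w.fn‖ := by rw [← e]
        _ ≤ ‖evolResidual 𝒜 w‖ + ‖𝒜.compLp w.fn‖ := norm_add_le _ _
        _ ≤ _ := by
          gcongr
          exact (norm_compLp_le_mul 𝒜 w.fn).trans (by gcongr)
    nlinarith [norm_nonneg w.dt, sq_nonneg (‖evolResidual 𝒜 w‖ - CA * ‖w.fn‖)]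
  rw [WT.norm_sq, sq_cA hθ hT.le]
  set a := ‖evolResidual 𝒜 w‖ ^ 2
  set b := ‖evalT 0 w‖ ^ 2
  set κ := kappaConst θ ρ T
  have ha : 0 ≤ a := sq_nonneg _
  have hb : 0 ≤ b := sq_nonneg _
  have h4 : ‖w.fn‖ ^ 2 ≤ θ⁻¹ * (b + θ⁻¹ * a + κ * (b + a)) := by
    rw [inv_mul_eq_div, le_div_iff₀ hθ]; linarith
  have h5 : (1 + 2 * CA ^ 2) * ‖w.fn‖ ^ 2
      ≤ (1 + 2 * CA ^ 2) * (θ⁻¹ * (b + θ⁻¹ * a + κ * (b + a))) := by gcongr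
  have h6 : (1 + 2 * CA ^ 2) * (θ⁻¹ * (b + θ⁻¹ * a + κ * (b + a))) ≤
      ((1 + 2 * CA ^ 2) * ((1 + κ) / θ) + (1 + 2 * CA ^ 2) * (κ / θ)
      + (1 + 2 * CA ^ 2) / θ ^ 2) * (a + b) := by
    have e : ((1 + 2 * CA ^ 2) * ((1 + κ) / θ) + (1 + 2 * CA ^ 2) * (κ / θ)
        + (1 + 2 * CA ^ 2) / θ ^ 2) * (a + b)
        = (1 + 2 * CA ^ 2) * (θ⁻¹ * ((1 + κ + κ + θ⁻¹) * (a + b))) := by field_simp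
    rw [e]
    gcongr
    have := inv_pos.2 hθ
    nlinarith [mul_nonneg hκ ha, mul_nonneg hκ hb, mul_nonneg this.le hb]
  nlinarith

/-- The parabolic operator as a bounded operator. -/
def parabolicCLM (hι : Function.Injective ι) (hT : 0 < T) (𝒜 : V →L[ℝ] StrongDual ℝ V) :
    WT ι T →L[ℝ] DataT V H T :=
  ((WithLp.prodContinuousLinearEquiv 2 ℝ (L2T T (StrongDual ℝ V)) H).symm :
      L2T T (StrongDual ℝ V) × H →L[ℝ] DataT V H T).comp
    ((WT.dtL ι T - (𝒜.compLpL 2 (timeMeasure T)).comp (WT.fnL ι T)).prod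
      (evalCLM hι hT ⟨le_rfl, hT.le⟩))

theorem parabolicCLM_apply (hι : Function.Injective ι) (hT : 0 < T) (w : WT ι T) :
    parabolicCLM hι hT 𝒜 w = parabolicOp ι T 𝒜 w := rfl

omit [CompleteSpace V] [CompleteSpace H] in
theorem norm_sq_parabolicOp (w : WT ι T) :
    ‖parabolicOp ι T 𝒜 w‖ ^ 2 = ‖evolResidual 𝒜 w‖ ^ 2 + ‖evalT 0 w‖ ^ 2 :=
  WithLp.prod_norm_sq_eq_of_L2 _

theorem norm_le_cA_mul (hι : Function.Injective ι) (hT : 0 < T)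
    (hA : IsGarding ι 𝒜 θ ρ) (hθ : 0 < θ) (hCA : ‖𝒜‖ ≤ CA) (w : WT ι T) :
    ‖w‖ ≤ cA θ ρ CA T * ‖parabolicOp ι T 𝒜 w‖ := by
  refine le_of_sq_le_sq ?_ (mul_nonneg (Real.sqrt_nonneg _) (norm_nonneg _))
  rw [mul_pow, norm_sq_parabolicOp]
  exact norm_sq_le_cA hι hT hA hθ hCA w

omit [CompleteSpace V] [CompleteSpace H] in
theorem evolResidual_reflect (w : WT ι T) : evolResidual 𝒜 w.reflect
    = reflectL2 T (StrongDual ℝ V) (-w.dt - 𝒜.compLp w.fn) := by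
  rw [evolResidual, WT.dt_reflect, WT.fn_reflect, compLp_reflectL2, map_sub, map_neg]

/-- The parabolic operator followed by the Riesz isomorphism. -/
def parabolicRiesz (hι : Function.Injective ι) (hT : 0 < T) (𝒜 : V →L[ℝ] StrongDual ℝ V) :
    WT ι T →L[ℝ] WithLp 2 (L2T T V × H) :=
  ((WithLp.prodContinuousLinearEquiv 2 ℝ (L2T T V) H).symm :
      L2T T V × H →L[ℝ] WithLp 2 (L2T T V × H)).comp
    (((rieszL2 T V).comp (WT.dtL ι T - (𝒜.compLpL 2 (timeMeasure T)).comp (WT.fnL ι T))).prod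
      (evalCLM hι hT ⟨le_rfl, hT.le⟩))

theorem parabolicRiesz_apply (hι : Function.Injective ι) (hT : 0 < T) (w : WT ι T) :
    parabolicRiesz hι hT 𝒜 w = WithLp.toLp 2 (rieszL2 T V (evolResidual 𝒜 w), evalT 0 w) := rfl

theorem norm_parabolicRiesz (hι : Function.Injective ι) (hT : 0 < T) (w : WT ι T) :
    ‖parabolicRiesz hι hT 𝒜 w‖ = ‖parabolicOp ι T 𝒜 w‖ := by
  rw [← sq_eq_sq₀ (norm_nonneg _) (norm_nonneg _), norm_sq_parabolicOp, parabolicRiesz_apply,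
    WithLp.prod_norm_sq_eq_of_L2, ← norm_rieszL2]
  rfl

/-- An element orthogonal to the range of the parabolic operator solves the adjoint equation. -/
theorem isWeakTimeDeriv_of_orthogonal (hT : 0 < T) {g : L2T T V} {k : H}
    (h : ∀ w : WT ι T, inner ℝ (rieszL2 T V (evolResidual 𝒜 w)) g + inner ℝ (evalT 0 w) k = 0) :
    IsWeakTimeDeriv ι T g (-𝒜.flip.compLp g) := by
  rw [isWeakTimeDeriv_iff]
  intro φ hφ hc hs v
  have hφ1 : ContDiff ℝ 1 φ := hφ.of_le (by simp)
  -- The test element φv vanishes at time 0, so k drops out.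
  have h1 := h (WT.smulConst ι T hT hφ1 v)
  have hφz : φ 0 = 0 := image_eq_zero_of_notMem_tsupport fun h => by simpa using hs h
  rw [evalT_smulConst hT hφ1 v ⟨le_rfl, hT.le⟩, hφz, zero_smul, inner_zero_left, add_zero,
    evolResidual, map_sub, inner_sub_left, WT.dt_smulConst, WT.fn_smulConst,
    inner_rieszL2_compLp_flip, rieszL2] at h1
  have h2 : (riesz V).compLpL 2 (timeMeasure T)
      (smulL2 T (hφ1.continuous_deriv le_rfl) (pivotEmb ι (ι v)))
      = smulL2 T (hφ1.continuous_deriv le_rfl) (gramOp ι v) := by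
    rw [gramOp_apply, ← riesz_pivotEmb]
    exact compLp_smulL2 _ _ _
  rw [h2, sub_eq_zero] at h1
  rw [h1, map_neg, inner_neg_right, neg_neg, real_inner_comm]
  rfl

/-- By orthogonality g is an element z of W_T with z' = −𝒜*z, and integration by parts leaves ⟨w(T),
z(T)⟩ = ⟨w(0), z(0) − k⟩ for every w. Density of ι(V) then allows the values at the two ends to be
separated. -/
theorem parabolicRiesz_orthogonal (hι : Function.Injective ι) (hd : DenseRange ι) (hT : 0 < T)
    (hA : IsGarding ι 𝒜 θ ρ) (hθ : 0 < θ) {g : L2T T V} {k : H}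
    (h : ∀ w : WT ι T, inner ℝ (rieszL2 T V (evolResidual 𝒜 w)) g + inner ℝ (evalT 0 w) k = 0) :
    g = 0 ∧ k = 0 := by
  let z : WT ι T := ⟨WithLp.toLp 2 (g, -𝒜.flip.compLp g), isWeakTimeDeriv_of_orthogonal hT h⟩
  have hzf : z.fn = g := rfl
  have hzd : z.dt = -𝒜.flip.compLp g := rfl
  have key : ∀ w : WT ι T, inner ℝ (evalT T w) (evalT T z)
      = inner ℝ (evalT 0 w) (evalT 0 z - k) := by
    intro w
    have h1 := inner_evalT_sub hι hT w z
    have h2 := h w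
    rw [evolResidual, map_sub, inner_sub_left, inner_rieszL2_compLp_flip] at h2
    rw [hzd, hzf, map_neg, inner_neg_left] at h1
    rw [inner_sub_right]
    linarith
  have hdense : ∀ {x : H}, (∀ v, inner ℝ (ι v) x = 0) → x = 0 := by
    intro x hx
    have : (fun y : H => inner ℝ y x) = fun _ => (0 : ℝ) :=
      hd.equalizer (by fun_prop) continuous_const (funext hx)
    exact inner_self_eq_zero.1 (congrFun this x)
  have h0 : (0 : ℝ) ∈ Icc 0 T := ⟨le_rfl, hT.le⟩
  have h1 : T ∈ Icc 0 T := ⟨hT.le, le_rfl⟩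
  have hzT : evalT T z = 0 := by
    refine hdense fun v => ?_
    -- The choice w = t v has w(0) = 0 and w(T) = T ι v.
    have := key (WT.smulConst ι T hT (contDiff_id (𝕜 := ℝ)) v)
    rw [evalT_smulConst hT contDiff_id v h1, evalT_smulConst hT contDiff_id v h0, id, id, zero_smul,
      inner_zero_left, real_inner_smul_left] at this
    exact (mul_eq_zero.1 this).resolve_left hT.ne'
  have hz0 : evalT 0 z - k = 0 := by
    refine hdense fun v => ?_
    have := key (WT.smulConst ι T hT (contDiff_const (c := (1 : ℝ))) v)
    rw [evalT_smulConst hT contDiff_const v h1, evalT_smulConst hT contDiff_const v h0, hzT,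
      inner_zero_right, one_smul] at this
    exact this.symm
  -- Reversed in time, z solves the homogeneous forward problem for 𝒜* from zero, so the a priori
  -- estimate gives z = 0.
  have hr : evolResidual 𝒜.flip z.reflect = 0 := by
    rw [evolResidual_reflect, hzd, hzf, neg_neg, sub_self, map_zero]
  have hz : z = 0 := by
    have h2 := norm_sq_le_cA hι hT hA.flip hθ le_rfl z.reflect
    rw [hr, evalT_reflect hι hT z h0, sub_zero, hzT, norm_zero, norm_zero, WT.norm_reflect] at h2
    have : ‖z‖ ^ 2 = 0 := le_antisymm (by simpa using h2) (sq_nonneg _)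
    exact norm_eq_zero.1 (pow_eq_zero_iff two_ne_zero |>.1 this)
  have hg : g = 0 := by rw [← hzf, hz]; rfl
  refine ⟨hg, ?_⟩
  have h3 : evalT 0 z = 0 := by
    rw [hz]; exact map_zero (evalCLM hι hT h0)
  rw [h3, zero_sub, neg_eq_zero] at hz0
  exact hz0

/-- The lower bound makes the range closed; in the Hilbert space L²(0,T;V) × H a closed subspace
with trivial orthogonal complement is everything. -/
theorem range_parabolicRiesz (hι : Function.Injective ι) (hd : DenseRange ι) (hT : 0 < T)
    (hA : IsGarding ι 𝒜 θ ρ) (hθ : 0 < θ) :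
    LinearMap.range (parabolicRiesz hι hT 𝒜 : WT ι T →ₗ[ℝ] WithLp 2 (L2T T V × H)) = ⊤ := by
  have hanti : AntilipschitzWith (Real.toNNReal (cA θ ρ ‖𝒜‖ T)) (parabolicRiesz hι hT 𝒜) := by
    refine AddMonoidHomClass.antilipschitz_of_bound _ fun w => ?_
    rw [norm_parabolicRiesz, Real.coe_toNNReal (cA θ ρ ‖𝒜‖ T) (Real.sqrt_nonneg _)]
    exact norm_le_cA_mul hι hT hA hθ le_rfl w
  have hcl : IsClosed (range (parabolicRiesz hι hT 𝒜)) :=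
    hanti.isClosed_range (parabolicRiesz hι hT 𝒜).uniformContinuous
  set S := LinearMap.range (parabolicRiesz hι hT 𝒜 : WT ι T →ₗ[ℝ] WithLp 2 (L2T T V × H)) with hS
  have hcl' : IsClosed (S : Set (WithLp 2 (L2T T V × H))) := hcl
  have : CompleteSpace S := hcl'.completeSpace_coe
  rw [← Submodule.orthogonal_eq_bot_iff, Submodule.eq_bot_iff]
  intro x hx
  have h := parabolicRiesz_orthogonal hι hd hT hA hθ (g := x.fst) (k := x.snd) fun w => by
    have := (Submodule.mem_orthogonal _ _).1 hx (parabolicRiesz hι hT 𝒜 w) ⟨w, rfl⟩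
    rwa [parabolicRiesz_apply, WithLp.prod_inner_apply] at this
  exact (WithLp.ext_iff 2).2 (Prod.ext h.1 h.2)

/-- Existence for the parabolic problem. -/
theorem exists_evolResidual_eq (hι : Function.Injective ι) (hd : DenseRange ι) (hT : 0 < T)
    (hA : IsGarding ι 𝒜 θ ρ) (hθ : 0 < θ) (F : L2T T (StrongDual ℝ V)) (k : H) :
    ∃ w : WT ι T, evolResidual 𝒜 w = F ∧ evalT 0 w = k := by
  have h : WithLp.toLp 2 (rieszL2 T V F, k) ∈
      LinearMap.range (parabolicRiesz hι hT 𝒜 : WT ι T →ₗ[ℝ] WithLp 2 (L2T T V × H)) := by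
    rw [range_parabolicRiesz hι hd hT hA hθ]; trivial
  obtain ⟨w, hw⟩ := h
  have hw' : WithLp.toLp 2 (rieszL2 T V (evolResidual 𝒜 w), evalT 0 w)
    = WithLp.toLp 2 (rieszL2 T V F, k) := hw
  have h1 := congrArg (fun x => (WithLp.ofLp x).1) hw'
  have h2 := congrArg (fun x => (WithLp.ofLp x).2) hw'
  exact ⟨w, rieszL2_injective h1, h2⟩

/-- The parabolic operator is an isomorphism. -/
theorem exists_parabolicEquiv (hι : Function.Injective ι) (hd : DenseRange ι) (hT : 0 < T)
    (hA : IsGarding ι 𝒜 θ ρ) (hθ : 0 < θ) (hCA : ‖𝒜‖ ≤ CA) :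
    ∃ A : WT ι T ≃L[ℝ] DataT V H T, (∀ w, A w = parabolicOp ι T 𝒜 w) ∧
      ‖(A.symm : DataT V H T →L[ℝ] WT ι T)‖ ≤ cA θ ρ CA T := by
  refine exists_equiv_of_bound (parabolicCLM hι hT 𝒜) (parabolicOp ι T 𝒜)
    (parabolicCLM_apply hι hT) (Real.sqrt_nonneg _)
    (norm_le_cA_mul hι hT hA hθ hCA) fun x => ?_
  obtain ⟨w, h1, h2⟩ := exists_evolResidual_eq hι hd hT hA hθ x.fst x.snd
  exact ⟨w, (WithLp.ext_iff 2).2 (Prod.ext h1 h2)⟩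

end Parabolic

/-! ### The optimality system: stability and existence -/

section Saddle

variable {V H U : Type*} [NormedAddCommGroup V] [InnerProductSpace ℝ V] [CompleteSpace V]
  [NormedAddCommGroup H] [InnerProductSpace ℝ H] [CompleteSpace H]
  [NormedAddCommGroup U] [InnerProductSpace ℝ U] [CompleteSpace U] {ι : V →L[ℝ] H} {T : ℝ}
  {𝒜 : V →L[ℝ] StrongDual ℝ V} {θ ρ CA cV cH : ℝ} {B : U →L[ℝ] H} {Q P : H →L[ℝ] H}

/-- The residual `-q' - 𝒜* q` of the backward problem. -/
def adjResidual (𝒜 : V →L[ℝ] StrongDual ℝ V) (q : WT ι T) : L2T T (StrongDual ℝ V) :=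
  -q.dt - 𝒜.flip.compLp q.fn

-- Time reversal turns the backward problem into a forward one for 𝒜*, which has the same Gårding
-- constants and norm; the backward theory is thus inherited without change of constants.
omit [CompleteSpace V] [CompleteSpace H] in
theorem adjResidual_eq_reflect (q : WT ι T) :
    adjResidual 𝒜 q = reflectL2 T (StrongDual ℝ V) (evolResidual 𝒜.flip q.reflect) := by
  rw [evolResidual_reflect, reflectL2_reflectL2, adjResidual]

/-- Duality between the forward and the backward problem. -/
theorem inner_evolResidual_add (hι : Function.Injective ι) (hT : 0 < T) (y q : WT ι T) :
    inner ℝ (rieszL2 T V (evolResidual 𝒜 y)) q.fn + inner ℝ (evalT 0 y) (evalT 0 q)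
      = inner ℝ (rieszL2 T V (adjResidual 𝒜 q)) y.fn + inner ℝ (evalT T y) (evalT T q) := by
  have h := inner_evalT_sub hι hT y q
  rw [evolResidual, adjResidual, map_sub, map_sub, inner_sub_left, inner_sub_left, map_neg,
    inner_neg_left, inner_rieszL2_compLp_flip 𝒜]
  linarith

theorem norm_sq_le_cA_backward (hι : Function.Injective ι) (hT : 0 < T)
    (hA : IsGarding ι 𝒜 θ ρ) (hθ : 0 < θ) (hCA : ‖𝒜‖ ≤ CA) (q : WT ι T) :
    ‖q‖ ^ 2 ≤ cA θ ρ CA T ^ 2 * (‖adjResidual 𝒜 q‖ ^ 2 + ‖evalT T q‖ ^ 2) := by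
  have h := norm_sq_le_cA hι hT hA.flip hθ (𝒜.opNorm_flip.trans_le hCA) q.reflect
  rwa [WT.norm_reflect, evalT_reflect hι hT q ⟨le_rfl, hT.le⟩, sub_zero,
    ← (reflectL2 T (StrongDual ℝ V)).norm_map (evolResidual 𝒜.flip q.reflect),
    ← adjResidual_eq_reflect] at h

theorem exists_adjResidual_eq (hι : Function.Injective ι) (hd : DenseRange ι) (hT : 0 < T)
    (hA : IsGarding ι 𝒜 θ ρ) (hθ : 0 < θ) (F : L2T T (StrongDual ℝ V)) (k : H) :
    ∃ q : WT ι T, adjResidual 𝒜 q = F ∧ evalT T q = k := by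
  obtain ⟨p, h1, h2⟩ := exists_evolResidual_eq hι hd hT hA.flip hθ
    (reflectL2 T (StrongDual ℝ V) F) k
  refine ⟨p.reflect, ?_, ?_⟩
  · rw [adjResidual, WT.dt_reflect, WT.fn_reflect, compLp_reflectL2, neg_neg, ← map_sub]
    change reflectL2 T (StrongDual ℝ V) (evolResidual 𝒜.flip p) = F
    rw [h1, reflectL2_reflectL2]
  · rw [evalT_reflect hι hT p ⟨hT.le, le_rfl⟩, sub_self, h2]

theorem norm_sq_compLp_le {X Y : Type*} [NormedAddCommGroup X] [NormedSpace ℝ X]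
    [NormedAddCommGroup Y] [NormedSpace ℝ Y] (L : X →L[ℝ] Y) {C : ℝ}
    (hL : ∀ x, ‖L x‖ ≤ C * ‖x‖) (f : L2T T X) : ‖L.compLp f‖ ^ 2 ≤ C ^ 2 * ‖f‖ ^ 2 := by
  -- C may be negative when X is trivial; only its square appears in the conclusion.
  have h1 : ‖L‖ ≤ |C| := L.opNorm_le_bound (abs_nonneg _) fun x =>
    (hL x).trans (mul_le_mul_of_nonneg_right (le_abs_self _) (norm_nonneg _))
  have h2 : ‖L.compLp f‖ ≤ |C| * ‖f‖ := (norm_compLp_le_mul L f).trans (by gcongr)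
  calc ‖L.compLp f‖ ^ 2 ≤ (|C| * ‖f‖) ^ 2 := by gcongr
    _ = _ := by rw [mul_pow, sq_abs]

theorem inner_rieszL2_pivotEmb (L : U →L[ℝ] H) (u : L2T T U) (v : L2T T V) :
    inner ℝ (rieszL2 T V ((pivotEmb ι ∘L L).compLp u)) v
      = inner ℝ u ((L.adjoint ∘L ι).compLp v) := by
  rw [inner_rieszL2, L2.inner_def]
  refine integral_congr_ae ?_
  filter_upwards [(pivotEmb ι ∘L L).coeFn_compLp u, (L.adjoint ∘L ι).coeFn_compLp v] with t h1 h2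
  rw [h1, h2]
  exact (L.adjoint_inner_right (u t) (ι (v t))).symm

theorem inner_rieszL2_observation (y v : L2T T V) :
    inner ℝ (rieszL2 T V ((pivotEmb ι ∘L Q.adjoint ∘L Q ∘L ι).compLp y)) v
      = inner ℝ ((Q ∘L ι).compLp y) ((Q ∘L ι).compLp v) := by
  have h := inner_rieszL2_pivotEmb (ι := ι) Q.adjoint ((Q ∘L ι).compLp y) v
  rw [ContinuousLinearMap.adjoint_adjoint, ← compLp_comp] at h
  exact h

omit [CompleteSpace V] [CompleteSpace H] [CompleteSpace U] in
theorem norm_sq_compLp_pivotEmb_le (hcH : ∀ h : H, ‖pivotEmb ι h‖ ≤ cH * ‖h‖) (u : L2T T U) :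
    ‖(pivotEmb ι ∘L B).compLp u‖ ^ 2 ≤ cH ^ 2 * ‖B‖ ^ 2 * ‖u‖ ^ 2 := by
  have h := norm_sq_compLp_le (pivotEmb ι ∘L B) (C := |cH| * ‖B‖) (fun x => ?_) u
  · rwa [mul_pow, sq_abs] at h
  · calc ‖pivotEmb ι (B x)‖ ≤ cH * ‖B x‖ := hcH _
      _ ≤ |cH| * (‖B‖ * ‖x‖) :=
        mul_le_mul (le_abs_self _) (B.le_opNorm x) (norm_nonneg _) (abs_nonneg _)
      _ = _ := by ring

omit [CompleteSpace V] [CompleteSpace H] in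
theorem norm_sq_observation_le (hcV : ∀ v : V, ‖ι v‖ ≤ cV * ‖v‖) (v : L2T T V) :
    ‖(Q ∘L ι).compLp v‖ ^ 2 ≤ ‖Q‖ ^ 2 * cV ^ 2 * ‖v‖ ^ 2 := by
  have h := norm_sq_compLp_le (Q ∘L ι) (C := ‖Q‖ * cV) (fun x => ?_) v
  · rwa [mul_pow] at h
  · calc ‖Q (ι x)‖ ≤ ‖Q‖ * ‖ι x‖ := Q.le_opNorm _
      _ ≤ ‖Q‖ * (cV * ‖x‖) := by gcongr; exact hcV x
      _ = _ := by ring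

omit [CompleteSpace V] in
theorem norm_sq_pivotEmb_observation_le (hcV : ∀ v : V, ‖ι v‖ ≤ cV * ‖v‖)
    (hcH : ∀ h : H, ‖pivotEmb ι h‖ ≤ cH * ‖h‖) (v : L2T T V) :
    ‖(pivotEmb ι ∘L Q.adjoint ∘L Q ∘L ι).compLp v‖ ^ 2
      ≤ cH ^ 2 * ‖Q.adjoint ∘L Q‖ ^ 2 * (cV ^ 2 * ‖v‖ ^ 2) := by
  have h1 := norm_sq_compLp_pivotEmb_le (B := Q.adjoint ∘L Q) hcH (ι.compLp v)
  have h2 := norm_sq_compLp_le ι hcV v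
  rw [← compLp_comp] at h1
  exact h1.trans (by gcongr)

omit [CompleteSpace U] in
/-- The state produced by a control with vanishing initial value. -/
theorem norm_sq_controlled_state_le (hι : Function.Injective ι) (hT : 0 < T)
    (hA : IsGarding ι 𝒜 θ ρ) (hθ : 0 < θ) (hCA : ‖𝒜‖ ≤ CA)
    (hcH : ∀ h : H, ‖pivotEmb ι h‖ ≤ cH * ‖h‖) {y : WT ι T} {u : L2T T U}
    (h1 : evolResidual 𝒜 y = (pivotEmb ι ∘L B).compLp u) (h2 : evalT 0 y = 0) :
    ‖y.fn‖ ^ 2 + ‖evalT T y‖ ^ 2 ≤ phiConst θ ρ CA cH B T * ‖u‖ ^ 2 := by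
  have hB := norm_sq_compLp_pivotEmb_le (T := T) (B := B) hcH u
  have h3 := norm_sq_le_cA hι hT hA hθ hCA y
  have h4 := norm_sq_evalT_le_data hι hT hA hθ y (t := T) ⟨hT.le, le_rfl⟩
  have hκ := kappaConst_nonneg (θ := θ) (ρ := ρ) hT.le
  rw [h1, h2, norm_zero] at h3 h4
  rw [WT.norm_sq] at h3
  have h5 : (θ⁻¹ + kappaConst θ ρ T + cA θ ρ CA T ^ 2) * ‖(pivotEmb ι ∘L B).compLp u‖ ^ 2
      ≤ (θ⁻¹ + kappaConst θ ρ T + cA θ ρ CA T ^ 2) * (cH ^ 2 * ‖B‖ ^ 2 * ‖u‖ ^ 2) := by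
    gcongr
  have e : phiConst θ ρ CA cH B T * ‖u‖ ^ 2
      = (θ⁻¹ + kappaConst θ ρ T + cA θ ρ CA T ^ 2) * (cH ^ 2 * ‖B‖ ^ 2 * ‖u‖ ^ 2) := by
    unfold phiConst; ring
  rw [e]
  nlinarith [sq_nonneg ‖y.dt‖]

omit [CompleteSpace H] [CompleteSpace U] in
theorem phiConst_nonneg (hθ : 0 < θ) (hT : 0 ≤ T) : 0 ≤ phiConst θ ρ CA cH B T := by
  have hκ := kappaConst_nonneg (θ := θ) (ρ := ρ) hT
  unfold phiConst
  positivity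

theorem cOne_nonneg (hθ : 0 < θ) (hT : 0 ≤ T) : 0 ≤ cOne θ ρ T := by
  have hκ := kappaConst_nonneg (θ := θ) (ρ := ρ) hT
  unfold cOne
  positivity

omit [CompleteSpace H] [CompleteSpace U] in
theorem sq_cU (hθ : 0 < θ) (hT : 0 ≤ T) : cU θ ρ CA cH cV B Q P T ^ 2
    = 2 * (‖Q‖ ^ 2 * cV ^ 2 * cA θ ρ CA T ^ 2 + ‖P‖ ^ 2 * cOne θ ρ T
      + 4 * phiConst θ ρ CA cH B T) := by
  have h1 := phiConst_nonneg (ρ := ρ) (CA := CA) (cH := cH) (B := B) hθ hT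
  have h2 := cOne_nonneg (ρ := ρ) hθ hT
  exact Real.sq_sqrt (by positivity)

omit [CompleteSpace H] [CompleteSpace U] in
theorem sq_cY : cY θ ρ CA cH cV B Q P T ^ 2
    = cA θ ρ CA T ^ 2 * (2 * (cH ^ 2 * ‖B‖ ^ 2 * cU θ ρ CA cH cV B Q P T ^ 2 + 1)) :=
  Real.sq_sqrt (by positivity)

omit [CompleteSpace U] in
theorem sq_cQ (hθ : 0 < θ) (hT : 0 ≤ T) : cQ θ ρ CA cH cV B Q P T ^ 2
    = cA θ ρ CA T ^ 2 * 2 *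
    (cH ^ 2 * (1 + ‖Q.adjoint ∘L Q‖ ^ 2 * cV ^ 2 * cY θ ρ CA cH cV B Q P T ^ 2) + 1
      + ‖P.adjoint ∘L P‖ ^ 2 * cOne θ ρ T
        * (2 * (cH ^ 2 * ‖B‖ ^ 2 * cU θ ρ CA cH cV B Q P T ^ 2 + 1))) := by
  have h2 := cOne_nonneg (ρ := ρ) hθ hT
  exact Real.sq_sqrt (by positivity)

omit [CompleteSpace U] in
theorem sq_cG : cG θ ρ CA cH cV B Q P T ^ 2
    = cY θ ρ CA cH cV B Q P T ^ 2 + cQ θ ρ CA cH cV B Q P T ^ 2 :=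
  Real.sq_sqrt (by positivity)

theorem norm_sq_evalT_le_cOne (hι : Function.Injective ι) (hT : 0 < T)
    (hA : IsGarding ι 𝒜 θ ρ) (hθ : 0 < θ) (y : WT ι T) :
    ‖evalT T y‖ ^ 2 ≤ cOne θ ρ T * (‖evolResidual 𝒜 y‖ ^ 2 + ‖evalT 0 y‖ ^ 2) := by
  have h := norm_sq_evalT_le_data hι hT hA hθ y (t := T) ⟨hT.le, le_rfl⟩
  have := inv_pos.2 hθ
  unfold cOne
  nlinarith [sq_nonneg ‖evolResidual 𝒜 y‖, mul_nonneg this.le (sq_nonneg ‖evalT 0 y‖)]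

/-- Cauchy–Schwarz in the product, then Young, with weights chosen so that m, later ‖u‖², appears
with the factor 1/2 and can be absorbed. -/
theorem inner_add_inner_le_half {X Y : Type*} [NormedAddCommGroup X] [InnerProductSpace ℝ X]
    [NormedAddCommGroup Y] [InnerProductSpace ℝ Y] {x x' : X} {y y' : Y} {M : ℝ}
    (hM : ‖x'‖ ^ 2 + ‖y'‖ ^ 2 ≤ M) {m c : ℝ} (hc : 0 ≤ c) (hm : 0 ≤ m) (hMc : M ≤ c * m) :
    inner ℝ x x' + inner ℝ y y' ≤ (c * (‖x‖ ^ 2 + ‖y‖ ^ 2) + m) / 2 := by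
  have h1 := real_inner_le_norm x x'
  have h2 := real_inner_le_norm y y'
  have h3 : (‖x‖ * ‖x'‖ + ‖y‖ * ‖y'‖) ^ 2 ≤ (‖x‖ ^ 2 + ‖y‖ ^ 2) * (c * m) := by
    have h4 : (‖x‖ * ‖x'‖ + ‖y‖ * ‖y'‖) ^ 2
        ≤ (‖x‖ ^ 2 + ‖y‖ ^ 2) * (‖x'‖ ^ 2 + ‖y'‖ ^ 2) := by
      nlinarith [sq_nonneg (‖x‖ * ‖y'‖ - ‖y‖ * ‖x'‖)]
    exact h4.trans (by gcongr; exact hM.trans hMc)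
  have h5 : ‖x‖ * ‖x'‖ + ‖y‖ * ‖y'‖ ≤ (c * (‖x‖ ^ 2 + ‖y‖ ^ 2) + m) / 2 := by
    refine le_of_sq_le_sq (h3.trans ?_) (by positivity)
    nlinarith [sq_nonneg (c * (‖x‖ ^ 2 + ‖y‖ ^ 2) - m)]
  linarith

/-- Completing the square: the quadratic observation of the controlled part pays for its cross term
with the uncontrolled part, so no smallness of Q or P is needed. -/
theorem neg_inner_sub_norm_sq_le {X : Type*} [NormedAddCommGroup X] [InnerProductSpace ℝ X]
    (x z : X) : -inner ℝ x z - ‖z‖ ^ 2 ≤ ‖x‖ ^ 2 / 4 := by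
  have h1 := (abs_le.1 (abs_real_inner_le_norm x z)).1
  nlinarith [sq_nonneg (‖x‖ / 2 - ‖z‖)]

/-- The weak form of the optimality condition, tested with the state `z` of a control `v`. -/
theorem inner_control_adjoint_state (hι : Function.Injective ι) (hT : 0 < T) {y q z : WT ι T}
    {v : L2T T U} {f₂ : L2T T (StrongDual ℝ V)} {h₂ : H}
    (hz : evolResidual 𝒜 z = (pivotEmb ι ∘L B).compLp v) (hz0 : evalT 0 z = 0)
    (e3 : adjResidual 𝒜 q = f₂ - (pivotEmb ι ∘L Q.adjoint ∘L Q ∘L ι).compLp y.fn)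
    (e4 : evalT T q = h₂ - P.adjoint (P (evalT T y))) :
    inner ℝ v ((B.adjoint ∘L ι).compLp q.fn) = inner ℝ (rieszL2 T V f₂) z.fn
      - inner ℝ ((Q ∘L ι).compLp y.fn) ((Q ∘L ι).compLp z.fn)
      + (inner ℝ h₂ (evalT T z) - inner ℝ (P (evalT T y)) (P (evalT T z))) := by
  have dual := inner_evolResidual_add (𝒜 := 𝒜) hι hT z q
  rw [hz, hz0, inner_zero_left, add_zero, inner_rieszL2_pivotEmb, e3, e4] at dual
  rw [dual, map_sub (rieszL2 T V), inner_sub_left, inner_sub_right, inner_rieszL2_observation,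
    P.adjoint_inner_right, real_inner_comm h₂, real_inner_comm (P (evalT T y))]

theorem eq_add_of_evolResidual_eq (hι : Function.Injective ι) (hT : 0 < T)
    (hA : IsGarding ι 𝒜 θ ρ) (hθ : 0 < θ) {x y z : WT ι T}
    (h : evolResidual 𝒜 y = evolResidual 𝒜 x + evolResidual 𝒜 z)
    (h0 : evalT 0 y = evalT 0 x + evalT 0 z) : y = x + z := by
  have e : parabolicCLM hι hT 𝒜 (y - (x + z)) = 0 := by
    rw [map_sub, map_add, sub_eq_zero]
    exact (WithLp.ext_iff 2).2 (Prod.ext h h0)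
  have h1 := norm_le_cA_mul hι hT hA hθ le_rfl (y - (x + z))
  rw [← parabolicCLM_apply hι hT, e, norm_zero, mul_zero] at h1
  exact sub_eq_zero.1 (norm_le_zero_iff.1 h1)

/-- The control of the optimality system, in terms of the state `x` without control. -/
theorem norm_sq_control_le_of_uncontrolled (hι : Function.Injective ι) (hd : DenseRange ι)
    (hT : 0 < T) (hA : IsGarding ι 𝒜 θ ρ) (hθ : 0 < θ) (hCA : ‖𝒜‖ ≤ CA)
    (hcH : ∀ h : H, ‖pivotEmb ι h‖ ≤ cH * ‖h‖)
    {x y q : WT ι T} {f₂ : L2T T (StrongDual ℝ V)} {h₂ : H}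
    (e1 : evolResidual 𝒜 y
      = evolResidual 𝒜 x + (pivotEmb ι ∘L B).compLp ((B.adjoint ∘L ι).compLp q.fn))
    (e2 : evalT 0 y = evalT 0 x)
    (e3 : adjResidual 𝒜 q = f₂ - (pivotEmb ι ∘L Q.adjoint ∘L Q ∘L ι).compLp y.fn)
    (e4 : evalT T q = h₂ - P.adjoint (P (evalT T y))) :
    ‖(B.adjoint ∘L ι).compLp q.fn‖ ^ 2 ≤ phiConst θ ρ CA cH B T * (‖f₂‖ ^ 2 + ‖h₂‖ ^ 2)
      + ‖(Q ∘L ι).compLp x.fn‖ ^ 2 / 2 + ‖P (evalT T x)‖ ^ 2 / 2 := by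
  have hTm : T ∈ Icc 0 T := ⟨hT.le, le_rfl⟩
  -- Here z is the state driven by u = B*q alone, so y = x + z. Testing the optimality condition
  -- with v = u expresses ‖u‖² through x, z and the data.
  obtain ⟨z, hz1, hz2⟩ := exists_evolResidual_eq hι hd hT hA hθ
    ((pivotEmb ι ∘L B).compLp ((B.adjoint ∘L ι).compLp q.fn)) 0
  have hy : y = x + z := eq_add_of_evolResidual_eq hι hT hA hθ (by rw [e1, hz1])
    (by rw [e2, hz2, add_zero])
  have dual := inner_control_adjoint_state hι hT hz1 hz2 e3 e4
  have hQ : (Q ∘L ι).compLp y.fn = (Q ∘L ι).compLp x.fn + (Q ∘L ι).compLp z.fn := by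
    rw [hy, WT.fn_add, compLp_linear_add]
  have hP : P (evalT T y) = P (evalT T x) + P (evalT T z) := by
    rw [hy, evalT_add hι hT x z hTm, map_add]
  rw [hQ, hP, inner_add_left, inner_add_left, real_inner_self_eq_norm_sq,
    real_inner_self_eq_norm_sq, real_inner_self_eq_norm_sq] at dual
  have b1 := neg_inner_sub_norm_sq_le ((Q ∘L ι).compLp x.fn) ((Q ∘L ι).compLp z.fn)
  have b2 := neg_inner_sub_norm_sq_le (P (evalT T x)) (P (evalT T z))
  have b3 := inner_add_inner_le_half (x := rieszL2 T V f₂) (y := h₂)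
    (norm_sq_controlled_state_le hι hT hA hθ hCA hcH hz1 hz2)
    (phiConst_nonneg hθ hT.le) (sq_nonneg _) le_rfl
  rw [norm_rieszL2] at b3
  linarith

/-- The estimate of the control in the optimality system: `y` is the state, `q` the adjoint state,
and `B* q` the control. -/
theorem norm_sq_control_le (hι : Function.Injective ι) (hd : DenseRange ι) (hT : 0 < T)
    (hA : IsGarding ι 𝒜 θ ρ) (hθ : 0 < θ) (hCA : ‖𝒜‖ ≤ CA)
    (hcV : ∀ v : V, ‖ι v‖ ≤ cV * ‖v‖) (hcH : ∀ h : H, ‖pivotEmb ι h‖ ≤ cH * ‖h‖)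
    {y q : WT ι T} {f₁ f₂ : L2T T (StrongDual ℝ V)} {h₁ h₂ : H}
    (e1 : evolResidual 𝒜 y = f₁ + (pivotEmb ι ∘L B).compLp ((B.adjoint ∘L ι).compLp q.fn))
    (e2 : evalT 0 y = h₁)
    (e3 : adjResidual 𝒜 q = f₂ - (pivotEmb ι ∘L Q.adjoint ∘L Q ∘L ι).compLp y.fn)
    (e4 : evalT T q = h₂ - P.adjoint (P (evalT T y))) :
    ‖(B.adjoint ∘L ι).compLp q.fn‖ ^ 2 ≤ cU θ ρ CA cH cV B Q P T ^ 2
      * (‖f₁‖ ^ 2 + ‖h₁‖ ^ 2 + (‖f₂‖ ^ 2 + ‖h₂‖ ^ 2)) := by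
  obtain ⟨x, hx1, hx2⟩ := exists_evolResidual_eq hι hd hT hA hθ f₁ h₁
  have main := norm_sq_control_le_of_uncontrolled hι hd hT hA hθ hCA hcH (by rw [e1, hx1])
    (e2.trans hx2.symm) e3 e4
  have b5 : ‖x.fn‖ ^ 2 ≤ cA θ ρ CA T ^ 2 * (‖f₁‖ ^ 2 + ‖h₁‖ ^ 2) := by
    have := norm_sq_le_cA hι hT hA hθ hCA x
    rw [hx1, hx2, WT.norm_sq] at this
    linarith [sq_nonneg ‖x.dt‖]
  have b6 : ‖P (evalT T x)‖ ^ 2 ≤ ‖P‖ ^ 2 * ‖evalT T x‖ ^ 2 := by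
    rw [← mul_pow]
    exact pow_le_pow_left₀ (norm_nonneg _) (P.le_opNorm _) 2
  have b7 := norm_sq_evalT_le_cOne hι hT hA hθ x
  rw [hx1, hx2] at b7
  have b8 := (norm_sq_observation_le (Q := Q) hcV x.fn).trans
    (mul_le_mul_of_nonneg_left b5 (by positivity))
  have b9 := b6.trans (mul_le_mul_of_nonneg_left b7 (by positivity))
  rw [sq_cU hθ hT.le]
  have hD1 : 0 ≤ ‖f₁‖ ^ 2 + ‖h₁‖ ^ 2 := by positivity
  have hD2 : 0 ≤ ‖f₂‖ ^ 2 + ‖h₂‖ ^ 2 := by positivity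
  have hφ := phiConst_nonneg (ρ := ρ) (CA := CA) (cH := cH) (B := B) hθ hT.le
  have hC := cOne_nonneg (ρ := ρ) hθ hT.le
  have c1 : 0 ≤ ‖Q‖ ^ 2 * cV ^ 2 * cA θ ρ CA T ^ 2 := by positivity
  have c2 : 0 ≤ ‖P‖ ^ 2 * cOne θ ρ T := by positivity
  refine main.trans ?_
  -- There is ample slack: the observation terms need only the factor 1/2 and φ only 1, where ℭ_u²
  -- provides 2 and 8.
  linarith only [b8, b9, mul_nonneg c1 hD1, mul_nonneg c2 hD1, mul_nonneg hφ hD1,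
    mul_nonneg c1 hD2, mul_nonneg c2 hD2, mul_nonneg hφ hD2]

theorem norm_add_sq_le_two_mul {X : Type*} [NormedAddCommGroup X] (a b : X) :
    ‖a + b‖ ^ 2 ≤ 2 * (‖a‖ ^ 2 + ‖b‖ ^ 2) := by
  have := norm_add_le a b
  nlinarith [norm_nonneg (a + b), sq_nonneg (‖a‖ - ‖b‖)]

/-- The stability estimate for the optimality system. -/
theorem norm_sq_optimality_le (hι : Function.Injective ι) (hd : DenseRange ι) (hT : 0 < T)
    (hA : IsGarding ι 𝒜 θ ρ) (hθ : 0 < θ) (hCA : ‖𝒜‖ ≤ CA)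
    (hcV : ∀ v : V, ‖ι v‖ ≤ cV * ‖v‖) (hcH : ∀ h : H, ‖pivotEmb ι h‖ ≤ cH * ‖h‖)
    {y q : WT ι T} {f₁ f₂ : L2T T (StrongDual ℝ V)} {h₁ h₂ : H}
    (e1 : evolResidual 𝒜 y = f₁ + (pivotEmb ι ∘L B).compLp ((B.adjoint ∘L ι).compLp q.fn))
    (e2 : evalT 0 y = h₁)
    (e3 : adjResidual 𝒜 q = f₂ - (pivotEmb ι ∘L Q.adjoint ∘L Q ∘L ι).compLp y.fn)
    (e4 : evalT T q = h₂ - P.adjoint (P (evalT T y))) :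
    ‖y‖ ^ 2 + ‖q‖ ^ 2 ≤ cG θ ρ CA cH cV B Q P T ^ 2
      * (‖f₁‖ ^ 2 + ‖h₁‖ ^ 2 + (‖f₂‖ ^ 2 + ‖h₂‖ ^ 2)) := by
  have hu := norm_sq_control_le hι hd hT hA hθ hCA hcV hcH e1 e2 e3 e4
  set u := (B.adjoint ∘L ι).compLp q.fn
  set D := ‖f₁‖ ^ 2 + ‖h₁‖ ^ 2 + (‖f₂‖ ^ 2 + ‖h₂‖ ^ 2) with hD
  have hD0 : 0 ≤ D := by positivity
  have hC := cOne_nonneg (ρ := ρ) hθ hT.le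
  have r1 : ‖evolResidual 𝒜 y‖ ^ 2 + ‖evalT 0 y‖ ^ 2
      ≤ (2 * (cH ^ 2 * ‖B‖ ^ 2 * cU θ ρ CA cH cV B Q P T ^ 2 + 1)) * D := by
    have a1 := norm_add_sq_le_two_mul f₁ ((pivotEmb ι ∘L B).compLp u)
    have a2 := norm_sq_compLp_pivotEmb_le (B := B) hcH u
    have a3 : cH ^ 2 * ‖B‖ ^ 2 * ‖u‖ ^ 2
        ≤ cH ^ 2 * ‖B‖ ^ 2 * (cU θ ρ CA cH cV B Q P T ^ 2 * D) := by gcongr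
    rw [e1, e2]
    linarith [sq_nonneg ‖h₁‖, sq_nonneg ‖f₁‖, sq_nonneg ‖f₂‖, sq_nonneg ‖h₂‖]
  have r2 : ‖y‖ ^ 2 ≤ cY θ ρ CA cH cV B Q P T ^ 2 * D := by
    rw [sq_cY, mul_assoc]
    exact (norm_sq_le_cA hι hT hA hθ hCA y).trans (by gcongr)
  have r3 : ‖evalT T y‖ ^ 2 ≤ cOne θ ρ T
      * ((2 * (cH ^ 2 * ‖B‖ ^ 2 * cU θ ρ CA cH cV B Q P T ^ 2 + 1)) * D) :=
    (norm_sq_evalT_le_cOne hι hT hA hθ y).trans (by gcongr)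
  have r4 : ‖adjResidual 𝒜 q‖ ^ 2 ≤ 2 * (‖f₂‖ ^ 2 + cH ^ 2 * (‖Q.adjoint ∘L Q‖ ^ 2 * cV ^ 2
      * (cY θ ρ CA cH cV B Q P T ^ 2 * D))) := by
    have a1 := norm_add_sq_le_two_mul f₂ (-(pivotEmb ι ∘L Q.adjoint ∘L Q ∘L ι).compLp y.fn)
    rw [norm_neg, ← sub_eq_add_neg, ← e3] at a1
    refine a1.trans ?_
    have a2 := norm_sq_pivotEmb_observation_le (Q := Q) hcV hcH y.fn
    have a3 : ‖y.fn‖ ^ 2 ≤ cY θ ρ CA cH cV B Q P T ^ 2 * D := by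
      rw [WT.norm_sq] at r2; linarith [sq_nonneg ‖y.dt‖]
    have a4 : cH ^ 2 * ‖Q.adjoint ∘L Q‖ ^ 2 * (cV ^ 2 * ‖y.fn‖ ^ 2)
        ≤ cH ^ 2 * ‖Q.adjoint ∘L Q‖ ^ 2 * (cV ^ 2 * (cY θ ρ CA cH cV B Q P T ^ 2 * D)) := by
      gcongr
    linarith
  have r5 : ‖evalT T q‖ ^ 2 ≤ 2 * (‖h₂‖ ^ 2 + ‖P.adjoint ∘L P‖ ^ 2 * (cOne θ ρ T
      * ((2 * (cH ^ 2 * ‖B‖ ^ 2 * cU θ ρ CA cH cV B Q P T ^ 2 + 1)) * D))) := by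
    have a1 := norm_add_sq_le_two_mul h₂ (-P.adjoint (P (evalT T y)))
    rw [norm_neg, ← sub_eq_add_neg, ← e4] at a1
    refine a1.trans ?_
    have a2 : ‖P.adjoint (P (evalT T y))‖ ^ 2 ≤ ‖P.adjoint ∘L P‖ ^ 2 * ‖evalT T y‖ ^ 2 := by
      rw [← mul_pow]; gcongr; exact (P.adjoint ∘L P).le_opNorm _
    have a3 : ‖P.adjoint ∘L P‖ ^ 2 * ‖evalT T y‖ ^ 2 ≤ ‖P.adjoint ∘L P‖ ^ 2 * (cOne θ ρ T
      * ((2 * (cH ^ 2 * ‖B‖ ^ 2 * cU θ ρ CA cH cV B Q P T ^ 2 + 1)) * D)) := by gcongr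
    linarith
  have r6 : ‖q‖ ^ 2 ≤ cQ θ ρ CA cH cV B Q P T ^ 2 * D := by
    refine (norm_sq_le_cA_backward hι hT hA hθ hCA q).trans ?_
    rw [sq_cQ hθ hT.le, mul_assoc, mul_assoc]
    gcongr
    -- The bare summand c_H² in ℭ_q² is surplus and is discarded here.
    have a1 : 0 ≤ cH ^ 2 * D := by positivity
    linarith [sq_nonneg ‖h₁‖, sq_nonneg ‖f₁‖]
  rw [sq_cG, add_mul]
  linarith

/-- The variational equation of a quadratic functional with two observation terms. -/
theorem exists_variational_solution {X Y Z : Type*} [NormedAddCommGroup X] [InnerProductSpace ℝ X]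
    [CompleteSpace X] [NormedAddCommGroup Y] [InnerProductSpace ℝ Y]
    [NormedAddCommGroup Z] [InnerProductSpace ℝ Z] (M : X →L[ℝ] Y) (N : X →L[ℝ] Z)
    (l : StrongDual ℝ X) :
    ∃ u : X, ∀ v, inner ℝ u v + inner ℝ (M u) (M v) + inner ℝ (N u) (N v) = l v := by
  let b : X →L[ℝ] X →L[ℝ] ℝ := innerSL ℝ + (innerSL ℝ : Y →L[ℝ] Y →L[ℝ] ℝ).bilinearComp M M
    + (innerSL ℝ : Z →L[ℝ] Z →L[ℝ] ℝ).bilinearComp N N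
  have hb : ∀ u v, b u v = inner ℝ u v + inner ℝ (M u) (M v) + inner ℝ (N u) (N v) :=
    fun u v => rfl
  have hco : IsCoercive b := by
    refine ⟨1, one_pos, fun v => ?_⟩
    rw [hb, real_inner_self_eq_norm_sq, real_inner_self_eq_norm_sq, real_inner_self_eq_norm_sq]
    nlinarith [sq_nonneg ‖M v‖, sq_nonneg ‖N v‖]
  refine ⟨hco.continuousLinearEquivOfBilin.symm (riesz X l), fun v => ?_⟩
  rw [← hb, ← hco.continuousLinearEquivOfBilin_apply, ContinuousLinearEquiv.apply_symm_apply,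
    inner_riesz]

omit [CompleteSpace U] in
/-- The control-to-state operator with vanishing initial value. -/
theorem exists_controlToState (hι : Function.Injective ι) (hd : DenseRange ι) (hT : 0 < T)
    (hA : IsGarding ι 𝒜 θ ρ) (hθ : 0 < θ) (B : U →L[ℝ] H) :
    ∃ S : L2T T U →L[ℝ] WT ι T, (∀ v, evolResidual 𝒜 (S v) = (pivotEmb ι ∘L B).compLp v) ∧
      ∀ v, evalT 0 (S v) = 0 := by
  obtain ⟨A, hA1, -⟩ := exists_parabolicEquiv hι hd hT hA hθ (le_refl ‖𝒜‖)
  let S : L2T T U →L[ℝ] WT ι T := (A.symm : DataT V H T →L[ℝ] WT ι T) ∘L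
    ((WithLp.prodContinuousLinearEquiv 2 ℝ (L2T T (StrongDual ℝ V)) H).symm :
      L2T T (StrongDual ℝ V) × H →L[ℝ] DataT V H T) ∘L
    (((pivotEmb ι ∘L B).compLpL 2 (timeMeasure T)).prod 0)
  have hS : ∀ v, parabolicOp ι T 𝒜 (S v)
      = WithLp.toLp 2 ((pivotEmb ι ∘L B).compLp v, (0 : H)) := by
    intro v
    rw [← hA1]
    exact A.apply_symm_apply _
  exact ⟨S, fun v => congrArg (fun x => (WithLp.ofLp x).1) (hS v),
    fun v => congrArg (fun x => (WithLp.ofLp x).2) (hS v)⟩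

/-- Existence of an optimal control. -/
theorem exists_optimal_control (hι : Function.Injective ι) (hT : 0 < T)
    (S : L2T T U →L[ℝ] WT ι T) (x : WT ι T) (g : L2T T V) (h : H) (Q P : H →L[ℝ] H) :
    ∃ u : L2T T U, ∀ v, inner ℝ u v
      + inner ℝ ((Q ∘L ι).compLp (S u).fn) ((Q ∘L ι).compLp (S v).fn)
      + inner ℝ (P (evalT T (S u))) (P (evalT T (S v)))
      = inner ℝ g (S v).fn + inner ℝ h (evalT T (S v))
        - inner ℝ ((Q ∘L ι).compLp x.fn) ((Q ∘L ι).compLp (S v).fn)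
        - inner ℝ (P (evalT T x)) (P (evalT T (S v))) :=
  -- The first-order condition for minimising ½‖u‖² + ½‖Q(x + Su)‖² + ½‖P(x + Su)(T)‖² − ⟨g, Su⟩ −
  -- ⟨h, (Su)(T)⟩.
  exists_variational_solution (((Q ∘L ι).compLpL 2 (timeMeasure T)) ∘L WT.fnL ι T ∘L S)
    (P ∘L evalCLM hι hT ⟨hT.le, le_rfl⟩ ∘L S)
    (innerSL ℝ g ∘L WT.fnL ι T ∘L S + innerSL ℝ h ∘L evalCLM hι hT ⟨hT.le, le_rfl⟩ ∘L S
      - innerSL ℝ ((Q ∘L ι).compLp x.fn) ∘L ((Q ∘L ι).compLpL 2 (timeMeasure T)) ∘L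
          WT.fnL ι T ∘L S
      - innerSL ℝ (P (evalT T x)) ∘L P ∘L evalCLM hι hT ⟨hT.le, le_rfl⟩ ∘L S)

omit [CompleteSpace V] [CompleteSpace H] in
theorem evolResidual_add (x z : WT ι T) :
    evolResidual 𝒜 (x + z) = evolResidual 𝒜 x + evolResidual 𝒜 z := by
  rw [evolResidual, evolResidual, evolResidual, WT.fn_add, WT.dt_add, compLp_linear_add]
  abel

/-- Existence for the optimality system. -/
theorem exists_optimality_solution (hι : Function.Injective ι) (hd : DenseRange ι) (hT : 0 < T)
    (hA : IsGarding ι 𝒜 θ ρ) (hθ : 0 < θ) (f₁ f₂ : L2T T (StrongDual ℝ V)) (h₁ h₂ : H) :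
    ∃ y q : WT ι T,
      evolResidual 𝒜 y = f₁ + (pivotEmb ι ∘L B).compLp ((B.adjoint ∘L ι).compLp q.fn) ∧
      evalT 0 y = h₁ ∧
      adjResidual 𝒜 q = f₂ - (pivotEmb ι ∘L Q.adjoint ∘L Q ∘L ι).compLp y.fn ∧
      evalT T q = h₂ - P.adjoint (P (evalT T y)) := by
  obtain ⟨x, hx1, hx2⟩ := exists_evolResidual_eq hι hd hT hA hθ f₁ h₁
  obtain ⟨S, hS1, hS2⟩ := exists_controlToState hι hd hT hA hθ B
  obtain ⟨u, hu⟩ := exists_optimal_control hι hT S x (rieszL2 T V f₂) h₂ Q P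
  obtain ⟨q, hq1, hq2⟩ := exists_adjResidual_eq hι hd hT hA hθ
    (f₂ - (pivotEmb ι ∘L Q.adjoint ∘L Q ∘L ι).compLp (x + S u).fn)
    (h₂ - P.adjoint (P (evalT T (x + S u))))
  have hQ : (Q ∘L ι).compLp (x + S u).fn
      = (Q ∘L ι).compLp x.fn + (Q ∘L ι).compLp (S u).fn := by
    rw [WT.fn_add, compLp_linear_add]
  have hP : P (evalT T (x + S u)) = P (evalT T x) + P (evalT T (S u)) := by
    rw [evalT_add hι hT x (S u) ⟨hT.le, le_rfl⟩, map_add]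
  -- The duality identity for q and the variational equation for u have the same right-hand side for
  -- each v, so B*q is the optimal control and the two equations are coupled as required.
  have hBq : (B.adjoint ∘L ι).compLp q.fn = u := by
    refine ext_inner_right ℝ fun v => ?_
    have dual := inner_control_adjoint_state hι hT (hS1 v) (hS2 v) hq1 hq2
    rw [hQ, hP, inner_add_left, inner_add_left] at dual
    rw [real_inner_comm, dual]
    linarith only [hu v]
  refine ⟨x + S u, q, ?_, ?_, hq1, hq2⟩
  · rw [hBq, ← hS1, ← hx1, evolResidual_add]
  · rw [evalT_add hι hT x (S u) ⟨le_rfl, hT.le⟩, hx2, hS2, add_zero]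

/-- The saddle point operator as a bounded operator. -/
def saddleCLM (hι : Function.Injective ι) (hT : 0 < T) (𝒜 : V →L[ℝ] StrongDual ℝ V)
    (B : U →L[ℝ] H) (Q P : H →L[ℝ] H) :
    WithLp 2 (WT ι T × WT ι T) →L[ℝ] WithLp 2 (DataT V H T × DataT V H T) :=
  let μ := timeMeasure T
  let p₁ := WithLp.fstL 2 ℝ (WT ι T) (WT ι T)
  let p₂ := WithLp.sndL 2 ℝ (WT ι T) (WT ι T)
  let e : L2T T (StrongDual ℝ V) × H →L[ℝ] DataT V H T :=
    (WithLp.prodContinuousLinearEquiv 2 ℝ (L2T T (StrongDual ℝ V)) H).symm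
  let E₀ := evalCLM (ι := ι) hι hT (⟨le_rfl, hT.le⟩ : (0 : ℝ) ∈ Icc 0 T)
  let E₁ := evalCLM (ι := ι) hι hT (⟨hT.le, le_rfl⟩ : T ∈ Icc 0 T)
  ((WithLp.prodContinuousLinearEquiv 2 ℝ (DataT V H T) (DataT V H T)).symm :
      DataT V H T × DataT V H T →L[ℝ] WithLp 2 (DataT V H T × DataT V H T)).comp
    ((e ∘L ((WT.dtL ι T ∘L p₁ - 𝒜.compLpL 2 μ ∘L WT.fnL ι T ∘L p₁
        - (pivotEmb ι ∘L B ∘L B.adjoint ∘L ι).compLpL 2 μ ∘L WT.fnL ι T ∘L p₂).prod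
        (E₀ ∘L p₁))).prod
      (e ∘L (((pivotEmb ι ∘L Q.adjoint ∘L Q ∘L ι).compLpL 2 μ ∘L WT.fnL ι T ∘L p₁
        - WT.dtL ι T ∘L p₂ - 𝒜.flip.compLpL 2 μ ∘L WT.fnL ι T ∘L p₂).prod
        (P.adjoint ∘L P ∘L E₁ ∘L p₁ + E₁ ∘L p₂))))

theorem saddleCLM_apply (hι : Function.Injective ι) (hT : 0 < T)
    (w : WithLp 2 (WT ι T × WT ι T)) :
    saddleCLM hι hT 𝒜 B Q P w = saddleOp ι T 𝒜 B Q P w := rfl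

omit [CompleteSpace V] in
theorem norm_sq_saddleOp (w : WithLp 2 (WT ι T × WT ι T)) :
    ‖saddleOp ι T 𝒜 B Q P w‖ ^ 2
      = ‖(saddleOp ι T 𝒜 B Q P w).fst.fst‖ ^ 2 + ‖(saddleOp ι T 𝒜 B Q P w).fst.snd‖ ^ 2
        + (‖(saddleOp ι T 𝒜 B Q P w).snd.fst‖ ^ 2 + ‖(saddleOp ι T 𝒜 B Q P w).snd.snd‖ ^ 2) := by
  rw [WithLp.prod_norm_sq_eq_of_L2, WithLp.prod_norm_sq_eq_of_L2, WithLp.prod_norm_sq_eq_of_L2]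

theorem norm_le_cG_mul (hι : Function.Injective ι) (hd : DenseRange ι) (hT : 0 < T)
    (hA : IsGarding ι 𝒜 θ ρ) (hθ : 0 < θ) (hCA : ‖𝒜‖ ≤ CA)
    (hcV : ∀ v : V, ‖ι v‖ ≤ cV * ‖v‖) (hcH : ∀ h : H, ‖pivotEmb ι h‖ ≤ cH * ‖h‖)
    (w : WithLp 2 (WT ι T × WT ι T)) :
    ‖w‖ ≤ cG θ ρ CA cH cV B Q P T * ‖saddleOp ι T 𝒜 B Q P w‖ := by
  refine le_of_sq_le_sq ?_ (mul_nonneg (Real.sqrt_nonneg _) (norm_nonneg _))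
  rw [mul_pow, norm_sq_saddleOp, WithLp.prod_norm_sq_eq_of_L2]
  refine norm_sq_optimality_le hι hd hT hA hθ hCA hcV hcH ?_ rfl ?_ ?_
  -- Factoring BB* exposes the control B*q in the state equation.
  · rw [← compLp_comp]
    change _ = w.fst.dt - 𝒜.compLp w.fst.fn
      - (pivotEmb ι ∘L B ∘L B.adjoint ∘L ι).compLp w.snd.fn + _
    exact (sub_add_cancel _ _).symm
  · change - w.snd.dt - 𝒜.flip.compLp w.snd.fn
      = (pivotEmb ι ∘L Q.adjoint ∘L Q ∘L ι).compLp w.fst.fn - w.snd.dt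
          - 𝒜.flip.compLp w.snd.fn - _
    abel
  · change evalT T w.snd = P.adjoint (P (evalT T w.fst)) + evalT T w.snd - _
    abel

theorem surjective_saddleOp (hι : Function.Injective ι) (hd : DenseRange ι) (hT : 0 < T)
    (hA : IsGarding ι 𝒜 θ ρ) (hθ : 0 < θ) :
    Function.Surjective (saddleOp ι T 𝒜 B Q P) := by
  intro x
  obtain ⟨y, q, e1, e2, e3, e4⟩ := exists_optimality_solution (B := B) (Q := Q) (P := P)
    hι hd hT hA hθ x.fst.fst x.snd.fst x.fst.snd x.snd.snd
  rw [← compLp_comp] at e1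
  refine ⟨WithLp.toLp 2 (y, q), (WithLp.ext_iff 2).2 (Prod.ext ((WithLp.ext_iff 2).2
    (Prod.ext ?_ e2)) ((WithLp.ext_iff 2).2 (Prod.ext ?_ ?_)))⟩
  · exact sub_eq_of_eq_add e1
  · change (pivotEmb ι ∘L Q.adjoint ∘L Q ∘L ι).compLp y.fn - q.dt - 𝒜.flip.compLp q.fn
      = x.snd.fst
    have e5 : x.snd.fst = adjResidual 𝒜 q
      + (pivotEmb ι ∘L Q.adjoint ∘L Q ∘L ι).compLp y.fn := by rw [e3, sub_add_cancel]
    rw [e5, adjResidual]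
    abel
  · change P.adjoint (P (evalT T y)) + evalT T q = x.snd.snd
    rw [e4, add_sub_cancel]

/-- The saddle point operator is an isomorphism. -/
theorem exists_saddleEquiv (hι : Function.Injective ι) (hd : DenseRange ι) (hT : 0 < T)
    (hA : IsGarding ι 𝒜 θ ρ) (hθ : 0 < θ) (hCA : ‖𝒜‖ ≤ CA)
    (hcV : ∀ v : V, ‖ι v‖ ≤ cV * ‖v‖) (hcH : ∀ h : H, ‖pivotEmb ι h‖ ≤ cH * ‖h‖) :
    ∃ G : WithLp 2 (WT ι T × WT ι T) ≃L[ℝ] WithLp 2 (DataT V H T × DataT V H T),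
      (∀ w, G w = saddleOp ι T 𝒜 B Q P w) ∧
      ‖(G.symm : WithLp 2 (DataT V H T × DataT V H T) →L[ℝ] WithLp 2 (WT ι T × WT ι T))‖
        ≤ cG θ ρ CA cH cV B Q P T :=
  exists_equiv_of_bound (X := WithLp 2 (WT ι T × WT ι T))
    (Y := WithLp 2 (DataT V H T × DataT V H T)) (saddleCLM (T := T) (ι := ι) hι hT 𝒜 B Q P)
    (saddleOp ι T 𝒜 B Q P) (saddleCLM_apply hι hT) (Real.sqrt_nonneg _)
    (norm_le_cG_mul hι hd hT hA hθ hCA hcV hcH) (surjective_saddleOp hι hd hT hA hθ)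

end Saddle

/-! ### Dependence of the constants on T -/

section ConstantsRegularity

variable {H U : Type*} [NormedAddCommGroup H] [InnerProductSpace ℝ H] [CompleteSpace H]
  [NormedAddCommGroup U] [InnerProductSpace ℝ U] {θ ρ CA cV cH : ℝ} {B : U →L[ℝ] H}
  {Q P : H →L[ℝ] H}

theorem continuous_cG : Continuous (cG θ ρ CA cH cV B Q P) := by
  unfold cG cQ cY cU phiConst cA cOne kappaConst
  fun_prop

theorem monotoneOn_kappaConst : MonotoneOn (kappaConst θ ρ) (Ici 0) := by
  intro s hs t ht hst
  have h0 : (0 : ℝ) ≤ s := hs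
  have h0' : (0 : ℝ) ≤ t := ht
  have h1 : 0 ≤ max ρ 0 := le_max_right _ _
  have h2 : 0 ≤ max 1 (1 / (2 * θ)) := zero_le_one.trans (le_max_left _ _)
  unfold kappaConst
  gcongr

/-- Each constant is a nondecreasing expression in the earlier ones; nonnegativity at the smaller
time is what lets squares and products preserve the order. -/
theorem monotoneOn_cG (hθ : 0 < θ) : MonotoneOn (cG θ ρ CA cH cV B Q P) (Ici 0) := by
  intro s hs t ht hst
  have hs0 : (0 : ℝ) ≤ s := hs
  have ht0 : (0 : ℝ) ≤ t := ht
  have hκ0 := kappaConst_nonneg (θ := θ) (ρ := ρ) hs0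
  have hκ : kappaConst θ ρ s ≤ kappaConst θ ρ t := monotoneOn_kappaConst hs ht hst
  have hC1 : cOne θ ρ s ≤ cOne θ ρ t := by unfold cOne; gcongr
  have hC0 : 0 ≤ cOne θ ρ s := by unfold cOne; positivity
  have hC0' : 0 ≤ cOne θ ρ t := hC0.trans hC1
  have hA0 : 0 ≤ cA θ ρ CA s := Real.sqrt_nonneg _
  have hA : cA θ ρ CA s ≤ cA θ ρ CA t := by
    unfold cA
    gcongr
  have hφ0 : 0 ≤ phiConst θ ρ CA cH B s := by unfold phiConst; positivity
  have hφ : phiConst θ ρ CA cH B s ≤ phiConst θ ρ CA cH B t := by unfold phiConst; gcongr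
  have hU0 : 0 ≤ cU θ ρ CA cH cV B Q P s := Real.sqrt_nonneg _
  have hU : cU θ ρ CA cH cV B Q P s ≤ cU θ ρ CA cH cV B Q P t := by unfold cU; gcongr
  have hY0 : 0 ≤ cY θ ρ CA cH cV B Q P s := Real.sqrt_nonneg _
  have hY : cY θ ρ CA cH cV B Q P s ≤ cY θ ρ CA cH cV B Q P t := by unfold cY; gcongr
  have hQ0 : 0 ≤ cQ θ ρ CA cH cV B Q P s := Real.sqrt_nonneg _
  have hQ : cQ θ ρ CA cH cV B Q P s ≤ cQ θ ρ CA cH cV B Q P t := by unfold cQ; gcongr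
  unfold cG
  gcongr

/-- The formula is continuous across T = 0, so boundedness near 0 is convergence to its value there.
-/
theorem isBoundedUnder_cG :
    (𝓝[>] (0 : ℝ)).IsBoundedUnder (· ≤ ·) (fun T => |cG θ ρ CA cH cV B Q P T|) :=
  ((continuous_cG.abs.tendsto 0).mono_left nhdsWithin_le_nhds).isBoundedUnder_le

end ConstantsRegularity

end

/-! ### The theorem -/

theorem mainTheorem5
    {V H U : Type*}
    [NormedAddCommGroup V] [InnerProductSpace ℝ V] [CompleteSpace V]
    [TopologicalSpace.SeparableSpace V]
    [NormedAddCommGroup H] [InnerProductSpace ℝ H] [CompleteSpace H]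
    [TopologicalSpace.SeparableSpace H]
    [NormedAddCommGroup U] [InnerProductSpace ℝ U] [CompleteSpace U] [FiniteDimensional ℝ U]
    -- the Gelfand triple and its embedding constants
    (ι : V →L[ℝ] H) (hι_inj : Function.Injective ι) (hι_dense : DenseRange ι)
    (cV cH : ℝ) (hcV : ∀ v : V, ‖ι v‖ ≤ cV * ‖v‖) (hcH : ∀ h : H, ‖pivotEmb ι h‖ ≤ cH * ‖h‖)
    (B : U →L[ℝ] H) (Q P : H →L[ℝ] H)
    -- the parametric operators and their bilinear forms
    (𝒜 : (ℕ → ℝ) → V →L[ℝ] StrongDual ℝ V) (a : (ℕ → ℝ) → V →L[ℝ] V →L[ℝ] ℝ)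
    (hA1 : ∀ σ ∈ paramSet, ∀ v w : V, 𝒜 σ v w = - a σ v w)
    (ρ θ : ℝ) (hθ : 0 < θ)
    (hA2 : ∀ σ ∈ paramSet, ∀ v : V, θ * ‖v‖ ^ 2 ≤ a σ v v + ρ * ‖ι v‖ ^ 2)
    (CA : ℝ) (hA3 : ∀ σ ∈ paramSet, ‖𝒜 σ‖ ≤ CA) :
    (∀ T : ℝ, 0 < T →
      (∀ w : WT ι T, ∃ u : ℝ → H, IsContRep w u) ∧
      ∀ σ ∈ paramSet,
        (∃ A : WT ι T ≃L[ℝ] DataT V H T,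
          (∀ w, A w = parabolicOp ι T (𝒜 σ) w) ∧
          ‖(A.symm : DataT V H T →L[ℝ] WT ι T)‖ ≤ cA θ ρ CA T) ∧
        (∃ G : WithLp 2 (WT ι T × WT ι T) ≃L[ℝ] WithLp 2 (DataT V H T × DataT V H T),
          (∀ w, G w = saddleOp ι T (𝒜 σ) B Q P w) ∧
          ‖(G.symm : WithLp 2 (DataT V H T × DataT V H T) →L[ℝ] WithLp 2 (WT ι T × WT ι T))‖
            ≤ cG θ ρ CA cH cV B Q P T)) ∧
    ContinuousOn (cG θ ρ CA cH cV B Q P) (Set.Ici 0) ∧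
    MonotoneOn (cG θ ρ CA cH cV B Q P) (Set.Ici 0) ∧
    (𝓝[>] (0 : ℝ)).IsBoundedUnder (· ≤ ·) (fun T => |cG θ ρ CA cH cV B Q P T|) := by
  refine ⟨fun T hT => ⟨fun w => ⟨_, isContRep_evalT hι_inj hT w⟩, fun σ hσ => ?_⟩,
    continuous_cG.continuousOn, monotoneOn_cG hθ, isBoundedUnder_cG⟩
  have hA : IsGarding ι (𝒜 σ) θ ρ := fun v => by
    rw [hA1 σ hσ v v]
    linarith [hA2 σ hσ v]
  exact ⟨exists_parabolicEquiv hι_inj hι_dense hT hA hθ (hA3 σ hσ),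
    exists_saddleEquiv hι_inj hι_dense hT hA hθ (hA3 σ hσ) hcV hcH⟩
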